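/- **Setting.** A mask is a finitely supported $c:\mathbb Z^2\to\mathbb R$; its symbol is $c(z_1,z_2)=\sum_\alpha c_\alpha z_1^{\alpha_1}z_2^{\alpha_2}$, its subdivision operator is $(\mathcal S_cf)_\alpha=\sum_\beta c_{\alpha-2\beta}f_\beta$, and $\|\mathcal S_c\|_\infty=\max_{\alpha\in\{0,1\}^2}\sum_\beta|c_{\alpha-2\beta}|$. A sequence of masks $c^{(k)}$, $k\ge 1$, is convergent if for every bounded $f^{(1)}=f:\mathbb Z^2\to\mathbb R$, with $f^{(k+1)}=\mathcal S_{c^{(k)}}f^{(k)}$, there is $g_f\in C(\mathbb R^2)$ with $\sup_\alpha|g_f(2^{-\ell}\alpha)-f^{(\ell+1)}_\alpha|\to0$, and $g_f\ne0$ for some $f$; it is $C^1$-convergent if moreover all $g_f$ are $C^1$. The basic limit function $\phi_k$ is the limit obtained from the data $\delta$ when one starts at level $k$. Let $n\ge 1$ be the valence of an extraordinary face or vertex of a triangular or quadrilateral mesh. Let $\Omega_1=\{u,v\ge0,\ 1\le\max(u,v)\le2\}$ (quadrilateral case) or $\{u,v\ge0,\ 1\le u+v\le2\}$ (triangular case),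 let $\Omega_k=2^{1-k}\Omega_1$, the union of three cells, and $\mathbf D_{n,k}=\Omega_k\times\mathbb Z_n$. A control net around the extraordinary element has $N$ control points, $p$ in each of $n$ sectors and, for a vertex, the vertex itself, and it is regular near each of the $3n$ cells; the positions of the control points are the same at every level and are rotationally symmetric. A rotationally symmetric non-stationary scheme $\mathscr S$ consists of masks $c^{(k)}$, $k\ge1$, with supports in a common finite set and of matrices $S_k\in\mathbb R^{N\times N}$, $k\ge1$, which commute with the rotation of the sectors. For initial control points $\mathbf d_1\in\mathbb R^{N\times3}$ put $\mathbf d_{k+1}=S_k\mathbf d_k$. The ring $\mathbf r_k:\mathbf D_{n,k}\to\mathbb R^3$ is $\mathbf r_k=\mathbf d_k^T\Phi_k$, where on each cell the entries of the vector $\Phi_k$ are the dilated and translated copies of $\phi_k$ that belong to the control points of the regular grid around this cell. The scheme is non-singular if in regular regions only zero data have the zero limit, and if the $S_k$ are non-singular on the control points that influence the next level: there is a set $A$ of control points, independent of $k$, such that the columns of every $S_k$ outside $A$ vanish and every block $(S_k)_{A\times A}$ is invertible (for $A$ the set of all control points: every $S_k$ is invertible). **Theorem.** Let $\mathscr S$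 be a rotationally symmetric, non-singular, non-stationary scheme such that for every $k\ge1$ the sum $\Phi_k^T\mathbf 1=\alpha_k$ of the entries of $\Phi_k$ is constant on $\mathbf D_{n,k}$. Let $\bar{\mathscr S}$ be a stationary scheme with mask $c$ and rotationally symmetric matrix $S\in\mathbb R^{N\times N}$ on the same net, which is standard: $S\mathbf 1=\mathbf 1$, the eigenvalue $1$ of $S$ is simple, $S$ has a real eigenvalue $\lambda_1\in(0,1)$ of algebraic and geometric multiplicity $2$, and all the other complex eigenvalues have modulus $<\lambda_1$. Assume: (i) $\bar{\mathscr S}$ is $C^1$-convergent in regular regions, $c(z_1,z_2)$ is divisible by $(1+z_1)(1+z_2)$ (as a Laurent polynomial), and the characteristic map is regular: if $x_1^0,x_1^1$ are linearly independent eigenvectors for $\lambda_1$ and $\bar\Phi$ is the vector of the basic limit functions of $\bar{\mathscr S}$ on $\mathbf D_{n,1}$, then the sign of the Jacobian determinant of $\bar\Phi^T(x_1^0,x_1^1)$ is non-zero and constant on $\mathbf D_{n,1}$; (ii) every symbol $c^{(k)}(z_1,z_2)$, $k\ge1$, is divisible by $(1+z_1)(1+z_2)$; (iii) $\sum_{k\ge1}2^k\|\mathcal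 S_{c^{(k)}}-\mathcal S_c\|_\infty<\infty$; (iv) there are constants $C$ and $\sigma>1/\lambda_1>1$ such that $\|S_k-S\|_\infty\le C/\sigma^k$ for all $k\ge1$. Then the limit surface of $\mathscr S$ is normal continuous at its extraordinary point. That is: $\mathscr S$ is $C^1$-convergent in regular regions; for every $\mathbf d_1$ there is $\mathbf r_c\in\mathbb R^3$ with $\sup_{\mathbf D_{n,k}}\|\mathbf r_k-\mathbf r_c\|_\infty\to0$; and for almost every $\mathbf d_1\in\mathbb R^{N\times3}$ we have $\partial_u\mathbf r_k\wedge\partial_v\mathbf r_k\ne0$ on $\mathbf D_{n,k}$ for all large $k$, and there is a unique vector $\mathbf n_\infty\in\mathbb R^3$ with $$\lim_{k\to\infty}\ \sup_{\mathbf D_{n,k}}\Big\|\frac{\partial_u\mathbf r_k\wedge\partial_v\mathbf r_k}{\|\partial_u\mathbf r_k\wedge\partial_v\mathbf r_k\|_2}-\mathbf n_\infty\Big\|_\infty=0 .$$ -/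

import Mathlib

open Filter Topology MeasureTheory

namespace Subdiv

noncomputable section

/-! ### Regular regions: masks, symbols, subdivision operators, limit functions -/

/-- A finitely supported subdivision mask. -/
abbrev Mask := (ℤ × ℤ) →₀ ℝ

/-- Scalar data on the lattice. -/
abbrev Data := ℤ × ℤ → ℝ

/-- One refinement step `(S_c f)_α = ∑_β c_{α - 2β} f_β` (a finite sum). -/
def subdivOp (c : Mask) (f : Data) : Data :=
  fun α => ∑ᶠ β : ℤ × ℤ, c (α - (2 : ℤ) • β) * f β

/-- `∑_β |c_{α - 2β}|`. -/
def cosetSum (c : Mask) (α : ℤ × ℤ) : ℝ := ∑ᶠ β : ℤ × ℤ, |c (α - (2 : ℤ) • β)|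

/-- The norm `‖S_c‖_∞` of the subdivision operator. -/
def opNorm (c : Mask) : ℝ :=
  max (max (cosetSum c (0, 0)) (cosetSum c (0, 1))) (max (cosetSum c (1, 0)) (cosetSum c (1, 1)))

/-- The symbol `c(z₁, z₂) = ∑_α c_α z₁^{α₁} z₂^{α₂}`. -/
def symbol (c : Mask) (z₁ z₂ : ℂ) : ℂ :=
  c.sum fun α a => (a : ℂ) * z₁ ^ α.1 * z₂ ^ α.2

/-- The symbol contains the factor `(1 + z₁)(1 + z₂)`: the quotient is again a Laurent
polynomial. -/
def HasFactor (c : Mask) : Prop :=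
  ∃ b : Mask, ∀ z₁ z₂ : ℂ, z₁ ≠ 0 → z₂ ≠ 0 →
    symbol c z₁ z₂ = (1 + z₁) * (1 + z₂) * symbol b z₁ z₂

/-- `S_{c^{(k+ℓ-1)}} ⋯ S_{c^{(k)}} f`: the data after `ℓ` steps that start at level `k`. -/
def refineData (c : ℕ → Mask) (k : ℕ) (f : Data) : ℕ → Data
  | 0 => f
  | ℓ + 1 => subdivOp (c (k + ℓ)) (refineData c k f ℓ)

/-- Bounded lattice data. -/
def BoundedData (f : Data) : Prop := ∃ M : ℝ, ∀ α, |f α| ≤ M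

/-- `g` is the continuous limit of the scheme that starts at level `k` with the data `f`:
`sup_α |g(2^{-ℓ} α) - f^{(k+ℓ)}_α| → 0`. -/
def IsLimit (c : ℕ → Mask) (k : ℕ) (f : Data) (g : ℝ × ℝ → ℝ) : Prop :=
  Continuous g ∧ ∀ ε > (0 : ℝ), ∀ᶠ ℓ : ℕ in atTop, ∀ α : ℤ × ℤ,
    |g ((α.1 : ℝ) / 2 ^ ℓ, (α.2 : ℝ) / 2 ^ ℓ) - refineData c k f ℓ α| ≤ ε

/-- Convergence of the scheme `c^{(1)}, c^{(2)}, …` in regular regions. -/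
def Convergent (c : ℕ → Mask) : Prop :=
  (∀ f, BoundedData f → ∃ g, IsLimit c 1 f g) ∧
    ∃ f g, BoundedData f ∧ IsLimit c 1 f g ∧ g ≠ 0

/-- `C¹`-convergence in regular regions. -/
def C1Convergent (c : ℕ → Mask) : Prop :=
  Convergent c ∧ ∀ f g, BoundedData f → IsLimit c 1 f g → ContDiff ℝ 1 g

/-- Non-singularity in regular regions: only zero data have the zero limit. -/
def NonSingularRegular (c : ℕ → Mask) : Prop :=
  ∀ f, BoundedData f → IsLimit c 1 f 0 → f = 0

/-- Asymptotical equivalence of order 1 of `c^{(1)}, c^{(2)}, …` and the stationary mask `c`: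
`∑_{k ≥ 1} 2^k ‖S_{c^{(k)}} - S_c‖_∞ < ∞`. -/
def AsympEquivOrderOne (ck : ℕ → Mask) (c : Mask) : Prop :=
  Summable fun k : ℕ => (2 : ℝ) ^ (k + 1) * opNorm (ck (k + 1) - c)

/-- The data `δ`. -/
def delta : Data := Pi.single 0 1

open Classical in
/-- The basic limit function `φ_k`: the limit of the scheme that starts at level `k` with the
data `δ` (unique if it exists; the value is `0` otherwise). -/
def basicLimit (c : ℕ → Mask) (k : ℕ) : ℝ × ℝ → ℝ :=
  if h : ∃ g, IsLimit c k delta g then h.choose else 0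

/-! ### The domain of the rings around an extraordinary element -/

/-- Triangular or quadrilateral meshes. -/
inductive MeshType
  | quad
  | tri

/-- The three cells of `Ω_1`. -/
def baseCell : MeshType → Fin 3 → Set (ℝ × ℝ)
  | .quad, 0 => {x | 1 ≤ x.1 ∧ x.1 ≤ 2 ∧ 0 ≤ x.2 ∧ x.2 ≤ 1}
  | .quad, 1 => {x | 1 ≤ x.1 ∧ x.1 ≤ 2 ∧ 1 ≤ x.2 ∧ x.2 ≤ 2}
  | .quad, 2 => {x | 0 ≤ x.1 ∧ x.1 ≤ 1 ∧ 1 ≤ x.2 ∧ x.2 ≤ 2}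
  | .tri, 0 => {x | 1 ≤ x.1 ∧ 0 ≤ x.2 ∧ x.1 + x.2 ≤ 2}
  | .tri, 1 => {x | x.1 ≤ 1 ∧ x.2 ≤ 1 ∧ 1 ≤ x.1 + x.2}
  | .tri, 2 => {x | 0 ≤ x.1 ∧ 1 ≤ x.2 ∧ x.1 + x.2 ≤ 2}

/-- The dilation factor `2^{k-1}` that maps `Ω_k` onto `Ω_1`. -/
def dil (k : ℕ) : ℝ := (2 : ℝ) ^ ((k : ℤ) - 1)

/-- The `i`-th cell of `Ω_k = 2^{1-k} Ω_1`. -/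
def cell (T : MeshType) (k : ℕ) (i : Fin 3) : Set (ℝ × ℝ) := {x | dil k • x ∈ baseCell T i}

/-- Uniform convergence to the constant `p` on the domains `Ω_k × ℤ_n`, i.e.
`sup_{Ω_k × ℤ_n} ‖F_k - p‖_∞ → 0`. The domain `Ω_k × ℤ_n` consists of the cells `i` of the
sectors `l`. -/
def RingTendsto {n : ℕ} (T : MeshType) (F : ℕ → ZMod n → Fin 3 → ℝ × ℝ → Fin 3 → ℝ)
    (p : Fin 3 → ℝ) : Prop :=
  ∀ ε > (0 : ℝ), ∀ᶠ k : ℕ in atTop, ∀ l i, ∀ x ∈ cell T k i, ‖F k l i x - p‖ ≤ ε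

/-! ### Control points near an extraordinary element -/

/-- An extraordinary face or an extraordinary vertex. -/
inductive ExtraElem
  | face
  | vertex

/-- The number of control points at the centre: an extraordinary vertex is a control point. -/
def ExtraElem.centers : ExtraElem → ℕ
  | .face => 0
  | .vertex => 1

/-- The control points around an extraordinary element of valence `n`: `n` sectors with `p`
points each and, in the case of a vertex, the vertex itself. -/
abbrev Idx (E : ExtraElem) (n p : ℕ) := Fin E.centers ⊕ (ZMod n × Fin p)

/-- Rotation by `l` sectors. -/
def rotate {E : ExtraElem} {n p : ℕ} (l : ZMod n) : Idx E n p → Idx E n p :=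
  Sum.map id fun a => (a.1 + l, a.2)

/-- Rotational symmetry of a local subdivision matrix. For a face this says that the matrix is
block-circulant; for a vertex it says that it is block-circulant up to the row and the column of
the central vertex, which have the same block for every sector. -/
def RotSymm {E : ExtraElem} {n p : ℕ} (S : Matrix (Idx E n p) (Idx E n p) ℝ) : Prop :=
  ∀ l a b, S (rotate l a) (rotate l b) = S a b

/-- The position of the control points relative to the cells. Close to a cell the mesh is regular;
`label i β` is the control point at the lattice position `β` of the regular grid around the `i`-th
cell in the sector `0`, and the other sectors are obtained by rotation. The value is relevant
only at the positions whose basis function does not vanish on the cell. An edge of a cell consists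
of `faces` edges of the mesh. -/
structure ControlNet (E : ExtraElem) (n p : ℕ) where
  meshType : MeshType
  faces : ℕ
  faces_pos : 0 < faces
  label : Fin 3 → ℤ × ℤ → Idx E n p

open Classical in
/-- The vector of functions on the `i`-th cell in the sector `l` at level `k` that
corresponds to the basic limit function `φ`: the entry of a control point is the
(dilated and translated) copy of `φ` that belongs to this point. -/
def basisVec {E : ExtraElem} {n p : ℕ} (net : ControlNet E n p) (φ : ℝ × ℝ → ℝ) (k : ℕ)
    (l : ZMod n) (i : Fin 3) (x : ℝ × ℝ) : Idx E n p → ℝ :=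
  fun a => ∑ᶠ β : ℤ × ℤ, if rotate l (net.label i β) = a then
    φ ((net.faces * dil k) • x - ((β.1 : ℝ), (β.2 : ℝ))) else 0

/-! ### Schemes -/

/-- A non-stationary, rotationally symmetric scheme: masks `c^{(k)}` with supports in a common
finite set, for the regular regions, and local subdivision matrices `S_k`, for the irregular
region, `k ≥ 1` (the values at `0` are not used). -/
structure Scheme (E : ExtraElem) (n p : ℕ) where
  mask : ℕ → Mask
  supp : Finset (ℤ × ℤ)
  mask_supp : ∀ k, 1 ≤ k → (mask k).support ⊆ supp
  mat : ℕ → Matrix (Idx E n p) (Idx E n p) ℝ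
  mat_symm : ∀ k, 1 ≤ k → RotSymm (mat k)

variable {E : ExtraElem} {n p : ℕ} [NeZero n]

/-- Non-singularity of the local subdivision matrices. The control points in `A` are those
that influence the next level; on them the refinement is a non-singular square matrix. The columns
of the remaining control points vanish: points at the outer boundary of the net, which enter only
the current ring, are of this kind. If all the matrices are non-singular, take for `A` the set of
all the control points. -/
def NonSingularLocal (S : ℕ → Matrix (Idx E n p) (Idx E n p) ℝ) : Prop :=
  ∃ A : Finset (Idx E n p), (∀ k, 1 ≤ k → ∀ a b, b ∉ A → S k a b = 0) ∧
    ∀ k, 1 ≤ k → ((S k).submatrix (fun a : A => (a : Idx E n p)) (fun a : A => a)).det ≠ 0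

/-- A non-singular scheme. -/
def Scheme.NonSingular (𝒮 : Scheme E n p) : Prop :=
  NonSingularRegular 𝒮.mask ∧ NonSingularLocal 𝒮.mat

/-- The control points: `d_1 = d`, `d_{k+1} = S_k d_k`. -/
def controlPoints (S : ℕ → Matrix (Idx E n p) (Idx E n p) ℝ) (d : Idx E n p → Fin 3 → ℝ) :
    ℕ → Idx E n p → Fin 3 → ℝ
  | 0 => d
  | 1 => d
  | k + 2 => fun a => ∑ b, S (k + 1) a b • controlPoints S d (k + 1) b

/-- The patch `r_k = d_kᵀ Φ_k` of the `k`-th ring of the limit surface on the `i`-th cell in the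
sector `l`. -/
def ringPatch (net : ControlNet E n p) (𝒮 : Scheme E n p) (d : Idx E n p → Fin 3 → ℝ) (k : ℕ)
    (l : ZMod n) (i : Fin 3) (x : ℝ × ℝ) : Fin 3 → ℝ :=
  ∑ a, basisVec net (basicLimit 𝒮.mask k) k l i x a • controlPoints 𝒮.mat d k a

/-- Partial derivative in the first variable. -/
def partialU {V : Type*} [NormedAddCommGroup V] [NormedSpace ℝ V] (F : ℝ × ℝ → V) (x : ℝ × ℝ) : V :=
  deriv (fun s => F (s, x.2)) x.1

/-- Partial derivative in the second variable. -/
def partialV {V : Type*} [NormedAddCommGroup V] [NormedSpace ℝ V] (F : ℝ × ℝ → V) (x : ℝ × ℝ) : V :=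
  deriv (fun s => F (x.1, s)) x.2

/-- The normal direction `∂_u r_k ∧ ∂_v r_k`. -/
def normalDir (net : ControlNet E n p) (𝒮 : Scheme E n p) (d : Idx E n p → Fin 3 → ℝ) (k : ℕ)
    (l : ZMod n) (i : Fin 3) (x : ℝ × ℝ) : Fin 3 → ℝ :=
  crossProduct (partialU (ringPatch net 𝒮 d k l i) x) (partialV (ringPatch net 𝒮 d k l i) x)

/-- The unit normal `n_k`; the vector is normalized in the Euclidean norm. -/
def unitNormal (net : ControlNet E n p) (𝒮 : Scheme E n p) (d : Idx E n p → Fin 3 → ℝ) (k : ℕ)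
    (l : ZMod n) (i : Fin 3) (x : ℝ × ℝ) : Fin 3 → ℝ :=
  ‖WithLp.toLp 2 (normalDir net 𝒮 d k l i x)‖⁻¹ • normalDir net 𝒮 d k l i x

/-- Convergence in the neighbourhood of the extraordinary element: for all initial data the
rings converge to a point. -/
def ConvergentIrregular (net : ControlNet E n p) (𝒮 : Scheme E n p) : Prop :=
  ∀ d : Idx E n p → Fin 3 → ℝ, ∃ rc : Fin 3 → ℝ, RingTendsto net.meshType (ringPatch net 𝒮 d) rc

/-- The limit surface is normal continuous at the limit point of the extraordinary elements. The
scheme is `C¹`-convergent in regular regions and convergent in the irregular region, and for almost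
all initial data the normals of the `k`-th ring are well defined for all large `k` and
converge uniformly to a unique vector. -/
def NormalContinuous (net : ControlNet E n p) (𝒮 : Scheme E n p) : Prop :=
  C1Convergent 𝒮.mask ∧ ConvergentIrregular net 𝒮 ∧
    ∀ᵐ d : Idx E n p → Fin 3 → ℝ,
      (∀ᶠ k : ℕ in atTop, ∀ l i, ∀ x ∈ cell net.meshType k i, normalDir net 𝒮 d k l i x ≠ 0) ∧
      ∃! ν : Fin 3 → ℝ, RingTendsto net.meshType (unitNormal net 𝒮 d) ν

/-! ### The stationary scheme -/

/-- The matrix norm `‖M‖_∞` (maximal absolute row sum). -/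
def rowSumNorm (M : Matrix (Idx E n p) (Idx E n p) ℝ) : ℝ := ⨆ a, ∑ b, |M a b|

/-- A standard local subdivision matrix with subdominant eigenvalue `l₁`: the eigenvalue `1` is
simple with eigenvector `(1, …, 1)`, the real number `0 < l₁ < 1` is a double and non-defective
eigenvalue, and all the other complex eigenvalues have modulus less than `l₁`. -/
structure IsStandard (S : Matrix (Idx E n p) (Idx E n p) ℝ) (l₁ : ℝ) : Prop where
  mulVec_one : S.mulVec (fun _ => 1) = fun _ => 1
  one_simple : S.charpoly.rootMultiplicity 1 = 1
  pos : 0 < l₁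
  lt_one : l₁ < 1
  double : S.charpoly.rootMultiplicity l₁ = 2
  nondefective : Module.finrank ℝ (Module.End.eigenspace (Matrix.toLin' S) l₁) = 2
  others : ∀ μ : ℂ, Polynomial.aeval μ S.charpoly = 0 → μ ≠ 1 → μ ≠ (l₁ : ℂ) → ‖μ‖ < l₁

/-- The component of the characteristic ring that belongs to the eigenvector `v`, on the `i`-th
cell of `Ω_1` in the sector `l`. -/
def charRing (net : ControlNet E n p) (c : Mask) (v : Idx E n p → ℝ) (l : ZMod n) (i : Fin 3)
    (x : ℝ × ℝ) : ℝ :=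
  ∑ a, basisVec net (basicLimit (fun _ => c) 1) 1 l i x a * v a

/-- Regularity of the characteristic map: for linearly independent eigenvectors `v₀`, `v₁`
of the eigenvalue `l₁` the sign of the Jacobian determinant of the planar characteristic ring is
non-zero and constant on `Ω_1 × ℤ_n`. -/
def RegularCharMap (net : ControlNet E n p) (c : Mask) (S : Matrix (Idx E n p) (Idx E n p) ℝ)
    (l₁ : ℝ) : Prop :=
  ∃ v : Fin 2 → Idx E n p → ℝ, LinearIndependent ℝ v ∧ (∀ j, S.mulVec (v j) = l₁ • v j) ∧
    ∃ s : SignType, s ≠ 0 ∧ ∀ l i, ∀ x ∈ cell net.meshType 1 i,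
      SignType.sign (Matrix.det
        !![partialU (charRing net c (v 0) l i) x, partialU (charRing net c (v 1) l i) x;
          partialV (charRing net c (v 0) l i) x, partialV (charRing net c (v 1) l i) x]) = s

end

end Subdiv

/-!
The proof has a regular part, an algebraic part, and a geometric part that joins them.

*Regular part.* The stationary scheme is stable: since the data `δ` have a continuous limit, the
powers of its subdivision operator are uniformly bounded (`exists_power_bound`), and
every limit function and its derivative are bounded in terms of the data (`exists_limit_bound`).
Starting at level `k` with data `f`, the non-stationary scheme differs from the stationary one in
step `m` by the defect `(S_{c^{(k+m)}} - S_c) f^{(k+m)}`. The limit is the stationary limit of `f`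
plus the sum over `m` of the stationary limits of the defects, dilated by `2^{m+1}`. The chain rule
costs the factor `2^{m+1}`, and this is exactly what asymptotical equivalence of order one makes
summable. Hence the limits are `C¹`, and the basic limit functions `φ_k` converge to the stationary
`φ` uniformly together with their derivatives (`exists_limit_of_asympEquiv`, `exists_C1Approx`).

*Algebraic part.* The space of control data splits into the eigenspaces of the eigenvalues `1`
and `l₁` and a complement on which the powers of `S` are `O(r ^ k)` with `r < l₁`
(`IsStandard.nonempty_splitting`). As `‖S_k - S‖ = O(σ ^ (-k))` with `1 / σ < l₁`, the control
points have the form `d_k = q_k + l₁ ^ (k - 1) z_k`, where all the entries of `q_k` are the same and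
`z_k` converges to `v₀ A + v₁ B` for the eigenvectors `v₀`, `v₁` of `l₁`; the vectors `A` and `B`
depend linearly on the initial data (`Splitting.exists_asymptotics`). The two functionals that
define them are linearly independent: the corresponding functionals that start at level `k` approach
the left eigenvectors of `S` as `k → ∞`, and a non-singular scheme reaches all the data at level `k`
that matter (`eq_zero_of_limit_functional_eq_zero`). So `A ∧ B ≠ 0` for almost all initial data
(`ae_cross_ne_zero`).

*Geometric part.* Since the basis functions sum up to a constant on a ring, `q_k` drops out of the
derivatives, and `∂_u r_k ∧ ∂_v r_k` is a positive multiple of a vector field that converges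
uniformly to `J • (A ∧ B)`, where `J` is the Jacobian determinant of the characteristic map. By
compactness of the cells `|J|` is bounded below, so the unit normals converge uniformly to
that of `± A ∧ B`, with the sign of `J` (`normals_tendsto`).
-/

namespace Subdiv

noncomputable section

/-! ### Subdivision operators on lattice data -/

theorem finite_support_coset (c : Mask) (α : ℤ × ℤ) :
    (Function.support fun β : ℤ × ℤ => c (α - (2 : ℤ) • β)).Finite := by
  have hinj : Function.Injective fun β : ℤ × ℤ => α - (2 : ℤ) • β := by
    intro a b h
    have h' : (2 : ℤ) • a = (2 : ℤ) • b := sub_right_injective h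
    exact smul_right_injective _ (two_ne_zero) h'
  refine (Set.Finite.preimage hinj.injOn c.hasFiniteSupport).subset ?_
  intro β hβ
  exact hβ

theorem finite_support_subdivOp (c : Mask) (f : Data) (α : ℤ × ℤ) :
    (Function.support fun β : ℤ × ℤ => c (α - (2 : ℤ) • β) * f β).Finite :=
  (finite_support_coset c α).subset fun _ hβ => left_ne_zero_of_mul hβ

theorem subdivOp_add (c : Mask) (f g : Data) :
    subdivOp c (f + g) = subdivOp c f + subdivOp c g := by
  funext α
  simp only [subdivOp, Pi.add_apply, mul_add]
  exact finsum_add_distrib (finite_support_subdivOp c f α) (finite_support_subdivOp c g α)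

theorem subdivOp_smul (c : Mask) (r : ℝ) (f : Data) :
    subdivOp c (r • f) = r • subdivOp c f := by
  funext α
  simp only [subdivOp, Pi.smul_apply, smul_eq_mul, mul_left_comm _ r]
  exact (mul_finsum _ r).symm

/-- The subdivision operator as a linear map. -/
def subdivLin (c : Mask) : Data →ₗ[ℝ] Data where
  toFun := subdivOp c
  map_add' := subdivOp_add c
  map_smul' := subdivOp_smul c

theorem subdivOp_sub_mask (c c' : Mask) (f : Data) :
    subdivOp (c - c') f = subdivOp c f - subdivOp c' f := by
  funext α
  simp only [subdivOp, Pi.sub_apply, Finsupp.coe_sub, sub_mul]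
  exact finsum_sub_distrib (finite_support_subdivOp c f α) (finite_support_subdivOp c' f α)

theorem cosetSum_add_two_smul (c : Mask) (α γ : ℤ × ℤ) :
    cosetSum c (α + (2 : ℤ) • γ) = cosetSum c α := by
  unfold cosetSum
  rw [← finsum_comp_equiv (Equiv.addRight γ)]
  refine finsum_congr fun β => ?_
  rw [Equiv.coe_addRight, smul_add, add_sub_add_right_eq_sub]

theorem cosetSum_le_opNorm (c : Mask) (α : ℤ × ℤ) : cosetSum c α ≤ opNorm c := by
  have h : α = (α.1 % 2, α.2 % 2) + (2 : ℤ) • (α.1 / 2, α.2 / 2) := by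
    ext <;> simp [Int.emod_add_mul_ediv]
  rw [h, cosetSum_add_two_smul]
  unfold opNorm
  rcases Int.emod_two_eq_zero_or_one α.1 with h1 | h1 <;>
  rcases Int.emod_two_eq_zero_or_one α.2 with h2 | h2 <;> rw [h1, h2] <;> simp

theorem opNorm_nonneg (c : Mask) : 0 ≤ opNorm c :=
  (finsum_nonneg fun _ => abs_nonneg _).trans (cosetSum_le_opNorm c 0)

theorem abs_subdivOp_le (c : Mask) {f : Data} {B : ℝ} (hf : ∀ α, |f α| ≤ B) (α : ℤ × ℤ) :
    |subdivOp c f α| ≤ opNorm c * B := by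
  have hB : 0 ≤ B := (abs_nonneg _).trans (hf 0)
  have hfin := finite_support_coset c α
  have h1 : subdivOp c f α = ∑ β ∈ hfin.toFinset, c (α - (2 : ℤ) • β) * f β :=
    finsum_eq_sum_of_support_subset _ fun β hβ => by
      simpa using left_ne_zero_of_mul hβ
  have h2 : cosetSum c α = ∑ β ∈ hfin.toFinset, |c (α - (2 : ℤ) • β)| :=
    finsum_eq_sum_of_support_subset _ fun β hβ => by simpa using hβ
  calc |subdivOp c f α| ≤ ∑ β ∈ hfin.toFinset, |c (α - (2 : ℤ) • β) * f β| := by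
        rw [h1]; exact Finset.abs_sum_le_sum_abs _ _
    _ ≤ ∑ β ∈ hfin.toFinset, |c (α - (2 : ℤ) • β)| * B := by
        gcongr with β _
        rw [abs_mul]
        exact mul_le_mul_of_nonneg_left (hf β) (abs_nonneg _)
    _ = cosetSum c α * B := by rw [h2, Finset.sum_mul]
    _ ≤ opNorm c * B := mul_le_mul_of_nonneg_right (cosetSum_le_opNorm c α) hB

/-- `ℓ` refinement steps that start at level `k`, as a linear map. -/
def refineLin (c : ℕ → Mask) (k : ℕ) : ℕ → Data →ₗ[ℝ] Data
  | 0 => LinearMap.id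
  | ℓ + 1 => subdivLin (c (k + ℓ)) ∘ₗ refineLin c k ℓ

theorem refineLin_apply (c : ℕ → Mask) (k ℓ : ℕ) (f : Data) :
    refineLin c k ℓ f = refineData c k f ℓ := by
  induction ℓ with
  | zero => rfl
  | succ ℓ ih => simp only [refineLin, refineData, LinearMap.comp_apply, ih]; rfl

theorem refineData_add (c : ℕ → Mask) (k ℓ : ℕ) (f g : Data) :
    refineData c k (f + g) ℓ = refineData c k f ℓ + refineData c k g ℓ := by
  simp only [← refineLin_apply, map_add]

theorem refineData_sub (c : ℕ → Mask) (k ℓ : ℕ) (f g : Data) :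
    refineData c k (f - g) ℓ = refineData c k f ℓ - refineData c k g ℓ := by
  simp only [← refineLin_apply, map_sub]

theorem refineData_const_succ (c : Mask) (k ℓ : ℕ) (f : Data) :
    refineData (fun _ => c) k f (ℓ + 1) = refineData (fun _ => c) k (subdivOp c f) ℓ := by
  induction ℓ with
  | zero => rfl
  | succ ℓ ih => rw [refineData, ih]; rfl

theorem BoundedData.subdivOp {f : Data} (hf : BoundedData f) (c : Mask) :
    BoundedData (subdivOp c f) :=
  hf.elim fun B hB => ⟨opNorm c * B, abs_subdivOp_le c hB⟩

theorem BoundedData.refineData {f : Data} (hf : BoundedData f) (c : ℕ → Mask) (k ℓ : ℕ) :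
    BoundedData (refineData c k f ℓ) := by
  induction ℓ with
  | zero => exact hf
  | succ ℓ ih => exact ih.subdivOp _

theorem abs_delta_le (α : ℤ × ℤ) : |delta α| ≤ 1 := by
  by_cases h : α = 0
  · subst h; simp [delta]
  · simp [delta, h]

theorem boundedData_delta : BoundedData delta := ⟨1, abs_delta_le⟩

/-- All the masks are supported in the ball of radius `R`. -/
def SuppRadius (c : ℕ → Mask) (k R : ℕ) : Prop :=
  ∀ j, k ≤ j → ∀ α, c j α ≠ 0 → ‖α‖ ≤ R

theorem SuppRadius.mono {c : ℕ → Mask} {k k' R : ℕ} (h : SuppRadius c k R) (hk : k ≤ k') :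
    SuppRadius c k' R := fun j hj => h j (hk.trans hj)

/-- Refinement is local: `ℓ` steps move information by at most `(2^ℓ - 1) R`. -/
theorem refineData_eq_zero {c : ℕ → Mask} {k R : ℕ} (hR : SuppRadius c k R) {f : Data} (ℓ : ℕ)
    (α : ℤ × ℤ) (h : ∀ β, ‖α - (2 ^ ℓ : ℤ) • β‖ ≤ (2 ^ ℓ - 1) * R → f β = 0) :
    refineData c k f ℓ α = 0 := by
  induction ℓ generalizing α with
  | zero => exact h α (by simp)
  | succ ℓ ih =>
    refine finsum_eq_zero_of_forall_eq_zero fun γ => ?_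
    by_cases hc : c (k + ℓ) (α - (2 : ℤ) • γ) = 0
    · rw [hc, zero_mul]
    rw [ih γ, mul_zero]
    intro β hβ
    apply h
    have e : α - (2 ^ (ℓ + 1) : ℤ) • β = (α - (2 : ℤ) • γ) + (2 : ℤ) • (γ - (2 ^ ℓ : ℤ) • β) := by
      rw [pow_succ', mul_smul, smul_sub]; abel
    have h1 := hR (k + ℓ) (by lia) _ hc
    have h2 : ‖(2 : ℤ) • (γ - (2 ^ ℓ : ℤ) • β)‖ = 2 * ‖γ - (2 ^ ℓ : ℤ) • β‖ := by
      rw [norm_smul, Int.norm_eq_abs]; norm_num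
    rw [e]
    refine (norm_add_le _ _).trans ?_
    rw [h2, pow_succ]
    linarith

theorem refineData_congr {c : ℕ → Mask} {k R : ℕ} (hR : SuppRadius c k R) {f g : Data} (ℓ : ℕ)
    (α : ℤ × ℤ) (h : ∀ β, ‖α - (2 ^ ℓ : ℤ) • β‖ ≤ (2 ^ ℓ - 1) * R → f β = g β) :
    refineData c k f ℓ α = refineData c k g ℓ α := by
  rw [← sub_eq_zero, ← Pi.sub_apply, ← refineData_sub]
  exact refineData_eq_zero hR ℓ α fun β hβ => by rw [Pi.sub_apply, h β hβ, sub_self]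

theorem subdivOp_translate (c : Mask) (f : Data) (β α : ℤ × ℤ) :
    subdivOp c (fun γ => f (γ - β)) α = subdivOp c f (α - (2 : ℤ) • β) := by
  unfold subdivOp
  rw [← finsum_comp_equiv (Equiv.addRight β)]
  refine finsum_congr fun γ => ?_
  simp only [Equiv.coe_addRight, add_sub_cancel_right, smul_add, sub_sub, add_comm ((2 : ℤ) • β)]

theorem refineData_translate (c : ℕ → Mask) (k ℓ : ℕ) (f : Data) (β : ℤ × ℤ) :
    refineData c k (fun γ => f (γ - β)) ℓ
      = fun α => refineData c k f ℓ (α - (2 ^ ℓ : ℤ) • β) := by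
  induction ℓ with
  | zero => funext α; simp [refineData]
  | succ ℓ ih =>
    funext α
    rw [refineData, ih, refineData, subdivOp_translate, smul_smul, ← pow_succ']

/-- Superposition: the refined data are a combination of translates of the refined `δ`. -/
theorem refineData_eq_sum {c : ℕ → Mask} {k R : ℕ} (hR : SuppRadius c k R) (f : Data) (ℓ : ℕ)
    (α : ℤ × ℤ) (Q : Finset (ℤ × ℤ))
    (hQ : ∀ β, ‖α - (2 ^ ℓ : ℤ) • β‖ ≤ (2 ^ ℓ - 1) * R → β ∈ Q) :
    refineData c k f ℓ α = ∑ β ∈ Q, f β * refineData c k delta ℓ (α - (2 ^ ℓ : ℤ) • β) := by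
  have h : refineData c k f ℓ α
      = refineData c k (∑ β ∈ Q, f β • fun γ => delta (γ - β)) ℓ α := by
    refine refineData_congr hR ℓ α fun β hβ => ?_
    rw [Finset.sum_apply, Finset.sum_eq_single β]
    · simp [delta]
    · intro b _ hb
      have : β - b ≠ 0 := sub_ne_zero.mpr hb.symm
      simp [delta, this]
    · intro hb
      exact absurd (hQ β hβ) hb
  rw [h, ← refineLin_apply, map_sum, Finset.sum_apply]
  refine Finset.sum_congr rfl fun β _ => ?_
  rw [map_smul, refineLin_apply, refineData_translate, Pi.smul_apply, smul_eq_mul]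

/-! ### Lattice points in the plane -/

/-- The embedding of the lattice into the plane. -/
def latt (β : ℤ × ℤ) : ℝ × ℝ := ((β.1 : ℝ), (β.2 : ℝ))

/-- The lattice point below `2^ℓ x`. -/
def flr (ℓ : ℕ) (x : ℝ × ℝ) : ℤ × ℤ := (⌊2 ^ ℓ * x.1⌋, ⌊2 ^ ℓ * x.2⌋)

theorem norm_latt (β : ℤ × ℤ) : ‖latt β‖ = ‖β‖ := by
  simp [latt, Prod.norm_def, Int.norm_eq_abs]

theorem flr_sub_latt (ℓ : ℕ) (x : ℝ × ℝ) (β : ℤ × ℤ) :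
    flr ℓ (x - latt β) = flr ℓ x - (2 ^ ℓ : ℤ) • β := by
  have h : ∀ (t : ℝ) (b : ℤ), ⌊2 ^ ℓ * (t - b)⌋ = ⌊2 ^ ℓ * t⌋ - 2 ^ ℓ * b := by
    intro t b
    rw [← Int.floor_sub_intCast]
    push_cast
    rw [mul_sub]
  ext <;> simp [flr, latt, h]

theorem norm_smul_sub_latt_flr_le (ℓ : ℕ) (x : ℝ × ℝ) :
    ‖(2 ^ ℓ : ℝ) • x - latt (flr ℓ x)‖ ≤ 1 := by
  have h : ∀ t : ℝ, |t - ⌊t⌋| ≤ 1 := fun t => by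
    rw [abs_of_nonneg (sub_nonneg.2 (Int.floor_le t))]
    linarith [Int.lt_floor_add_one t]
  simp only [Prod.norm_def, flr, latt, Prod.fst_sub, Prod.snd_sub, Prod.smul_fst, Prod.smul_snd,
    smul_eq_mul, Real.norm_eq_abs]
  exact max_le (h _) (h _)

theorem tendsto_flr (x : ℝ × ℝ) :
    Tendsto (fun ℓ : ℕ => (((flr ℓ x).1 : ℝ) / 2 ^ ℓ, ((flr ℓ x).2 : ℝ) / 2 ^ ℓ)) atTop (𝓝 x) := by
  rw [tendsto_iff_norm_sub_tendsto_zero]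
  have h0 : Tendsto (fun ℓ : ℕ => ((1 : ℝ) / 2) ^ ℓ) atTop (𝓝 0) :=
    tendsto_pow_atTop_nhds_zero_of_lt_one (by norm_num) (by norm_num)
  refine squeeze_zero (fun _ => norm_nonneg _) (fun ℓ => ?_) h0
  have h2 : (0 : ℝ) < 2 ^ ℓ := by positivity
  have e : (((flr ℓ x).1 : ℝ) / 2 ^ ℓ, ((flr ℓ x).2 : ℝ) / 2 ^ ℓ) - x
      = -((2 ^ ℓ : ℝ)⁻¹ • ((2 ^ ℓ : ℝ) • x - latt (flr ℓ x))) := by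
    ext <;> simp [latt] <;> field_simp <;> ring
  rw [e, norm_neg, norm_smul, norm_inv, Real.norm_of_nonneg h2.le, one_div, inv_pow]
  exact mul_le_of_le_one_right (by positivity) (norm_smul_sub_latt_flr_le ℓ x)

/-- The lattice points in the ball of radius `r`. -/
def lattBall (r : ℝ) : Finset (ℤ × ℤ) :=
  (isCompact_closedBall (0 : ℤ × ℤ) r).finite_of_discrete.toFinset

theorem mem_lattBall {r : ℝ} {β : ℤ × ℤ} : β ∈ lattBall r ↔ ‖β‖ ≤ r := by
  simp [lattBall]

/-! ### Limit functions -/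

theorem IsLimit.tendsto {c : ℕ → Mask} {k : ℕ} {f : Data} {g : ℝ × ℝ → ℝ} (h : IsLimit c k f g)
    (x : ℝ × ℝ) : Tendsto (fun ℓ => refineData c k f ℓ (flr ℓ x)) atTop (𝓝 (g x)) := by
  have h1 := (h.1.tendsto x).comp (tendsto_flr x)
  have h2 : Tendsto (fun ℓ : ℕ => g (((flr ℓ x).1 : ℝ) / 2 ^ ℓ, ((flr ℓ x).2 : ℝ) / 2 ^ ℓ)
      - refineData c k f ℓ (flr ℓ x)) atTop (𝓝 0) := by
    rw [Metric.tendsto_atTop]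
    intro ε hε
    obtain ⟨L, hL⟩ := eventually_atTop.1 (h.2 (ε / 2) (by linarith))
    refine ⟨L, fun ℓ hℓ => ?_⟩
    rw [Real.dist_eq, sub_zero]
    exact (hL ℓ hℓ _).trans_lt (by linarith)
  simpa using h1.sub h2

theorem IsLimit.unique {c : ℕ → Mask} {k : ℕ} {f : Data} {g g' : ℝ × ℝ → ℝ}
    (h : IsLimit c k f g) (h' : IsLimit c k f g') : g = g' :=
  funext fun x => tendsto_nhds_unique (h.tendsto x) (h'.tendsto x)

theorem basicLimit_eq {c : ℕ → Mask} {k : ℕ} {g : ℝ × ℝ → ℝ} (h : IsLimit c k delta g) :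
    basicLimit c k = g := by
  have hex : ∃ g, IsLimit c k delta g := ⟨g, h⟩
  rw [basicLimit, dif_pos hex]
  exact hex.choose_spec.unique h

theorem IsLimit.eq_zero_of_lt {c : ℕ → Mask} {k R : ℕ} (hR : SuppRadius c k R) {φ : ℝ × ℝ → ℝ}
    (h : IsLimit c k delta φ) {x : ℝ × ℝ} (hx : R < ‖x‖) : φ x = 0 := by
  refine tendsto_nhds_unique (h.tendsto x) (tendsto_const_nhds.congr' ?_)
  have h1 : Tendsto (fun ℓ : ℕ => (2 : ℝ) ^ ℓ * (‖x‖ - R)) atTop atTop :=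
    (tendsto_pow_atTop_atTop_of_one_lt (by norm_num)).atTop_mul_const (sub_pos.2 hx)
  filter_upwards [h1.eventually_gt_atTop 1] with ℓ hℓ
  refine (refineData_eq_zero hR ℓ _ fun β hβ => ?_).symm
  by_cases h0 : β = 0
  · exfalso
    subst h0
    rw [smul_zero, sub_zero, ← norm_latt] at hβ
    have h2 := norm_smul_sub_latt_flr_le ℓ x
    have h3 := norm_le_insert' ((2 ^ ℓ : ℝ) • x) (latt (flr ℓ x))
    rw [norm_smul, norm_pow, Real.norm_of_nonneg (by norm_num : (0 : ℝ) ≤ 2)] at h3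
    have : (0 : ℝ) ≤ R := Nat.cast_nonneg R
    nlinarith
  · simp [delta, h0]

/-- Every limit function is locally a finite combination of translates of the basic limit
function. -/
theorem IsLimit.eq_sum {c : ℕ → Mask} {k R : ℕ} (hR : SuppRadius c k R) {φ g : ℝ × ℝ → ℝ}
    {f : Data} (hφ : IsLimit c k delta φ) (hg : IsLimit c k f g) {β₀ : ℤ × ℤ} {r : ℝ} {x : ℝ × ℝ}
    (hx : ‖x - latt β₀‖ ≤ r) :
    g x = ∑ γ ∈ lattBall (R + r + 1), f (β₀ + γ) * φ (x - latt (β₀ + γ)) := by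
  refine tendsto_nhds_unique (hg.tendsto x) ?_
  have h : Tendsto (fun ℓ => ∑ γ ∈ lattBall (R + r + 1),
      f (β₀ + γ) * refineData c k delta ℓ (flr ℓ (x - latt (β₀ + γ)))) atTop
      (𝓝 (∑ γ ∈ lattBall (R + r + 1), f (β₀ + γ) * φ (x - latt (β₀ + γ)))) :=
    tendsto_finsetSum _ fun γ _ => (hφ.tendsto _).const_mul _
  refine h.congr fun ℓ => ?_
  rw [refineData_eq_sum hR f ℓ (flr ℓ x) ((lattBall (R + r + 1)).map (addLeftEmbedding β₀)),
    Finset.sum_map]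
  · simp only [addLeftEmbedding_apply, flr_sub_latt]
  · intro β hβ
    rw [Finset.mem_map]
    refine ⟨β - β₀, mem_lattBall.2 ?_, by simp⟩
    -- the lattice point `flr ℓ x` has distance at most `1` from `2^ℓ x`
    have h2 : (0 : ℝ) < 2 ^ ℓ := by positivity
    have h1 : (1 : ℝ) ≤ 2 ^ ℓ := one_le_pow₀ (by norm_num)
    have e : (2 ^ ℓ : ℝ) • latt (β - β₀) = (2 ^ ℓ : ℝ) • (x - latt β₀)
        - ((2 ^ ℓ : ℝ) • x - latt (flr ℓ x)) - latt (flr ℓ x - (2 ^ ℓ : ℤ) • β) := by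
      ext <;> simp [latt] <;> ring
    have h3 : ‖(2 ^ ℓ : ℝ) • latt (β - β₀)‖ ≤ 2 ^ ℓ * r + 1 + (2 ^ ℓ - 1) * R := by
      rw [e]
      refine (norm_sub_le _ _).trans (add_le_add ((norm_sub_le _ _).trans (add_le_add ?_ ?_)) ?_)
      · rw [norm_smul, norm_pow, Real.norm_of_nonneg (by norm_num : (0 : ℝ) ≤ 2)]
        gcongr
      · exact norm_smul_sub_latt_flr_le ℓ x
      · rwa [norm_latt]
    rw [norm_smul, norm_pow, Real.norm_of_nonneg (by norm_num : (0 : ℝ) ≤ 2), norm_latt] at h3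
    have : (0 : ℝ) ≤ R := Nat.cast_nonneg R
    refine le_of_mul_le_mul_left ?_ h2
    nlinarith

/-! ### Bounds for a scheme with a `C¹` basic limit function -/

theorem exists_suppRadius (F : Finset (ℤ × ℤ)) : ∃ R : ℕ, ∀ α ∈ F, ‖α‖ ≤ R := by
  obtain ⟨R, hR⟩ := exists_nat_ge (∑ α ∈ F, ‖α‖)
  exact ⟨R, fun α hα =>
    (Finset.single_le_sum (f := fun α => ‖α‖) (fun _ _ => norm_nonneg _) hα).trans hR⟩

theorem IsLimit.hasCompactSupport {c : ℕ → Mask} {k R : ℕ} (hR : SuppRadius c k R)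
    {φ : ℝ × ℝ → ℝ} (h : IsLimit c k delta φ) : HasCompactSupport φ := by
  refine HasCompactSupport.intro (isCompact_closedBall 0 (R : ℝ)) fun x hx => ?_
  exact h.eq_zero_of_lt hR (by simpa using hx)

/-- A limit function and its derivative are bounded in terms of the data: locally it is the
combination of a fixed number of translates of the basic limit function. -/
theorem exists_limit_bound {c : ℕ → Mask} {k R : ℕ} (hR : SuppRadius c k R) {φ : ℝ × ℝ → ℝ}
    (hφ : IsLimit c k delta φ) (hφ1 : ContDiff ℝ 1 φ) :
    ∃ K : ℝ, 0 ≤ K ∧ ∀ f B g, (∀ α, |f α| ≤ B) → IsLimit c k f g →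
      ∀ x, |g x| ≤ K * B ∧ ‖fderiv ℝ g x‖ ≤ K * B := by
  have hcs := hφ.hasCompactSupport hR
  obtain ⟨K₀, hK₀⟩ := hφ1.continuous.bounded_above_of_compact_support hcs
  obtain ⟨K₁, hK₁⟩ :=
    (hφ1.continuous_fderiv one_ne_zero).bounded_above_of_compact_support (hcs.fderiv (𝕜 := ℝ))
  have hK₀0 : 0 ≤ K₀ := (norm_nonneg _).trans (hK₀ 0)
  have hK₁0 : 0 ≤ K₁ := (norm_nonneg _).trans (hK₁ 0)
  set Q := lattBall (R + 2 + 1) with hQ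
  refine ⟨Q.card * (K₀ + K₁), by positivity, fun f B g hf hg x => ?_⟩
  have hB : 0 ≤ B := (abs_nonneg _).trans (hf 0)
  have hx1 : ‖x - latt (flr 0 x)‖ ≤ 1 := by simpa using norm_smul_sub_latt_flr_le 0 x
  have hloc : ∀ y, ‖y - latt (flr 0 x)‖ ≤ 2 →
      g y = ∑ γ ∈ Q, f (flr 0 x + γ) * φ (y - latt (flr 0 x + γ)) :=
    fun y hy => hφ.eq_sum hR hg hy
  have hderiv : HasFDerivAt g
      (∑ γ ∈ Q, f (flr 0 x + γ) • fderiv ℝ φ (x - latt (flr 0 x + γ))) x := by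
    have h1 : HasFDerivAt (fun y => ∑ γ ∈ Q, f (flr 0 x + γ) * φ (y - latt (flr 0 x + γ)))
        (∑ γ ∈ Q, f (flr 0 x + γ) • fderiv ℝ φ (x - latt (flr 0 x + γ))) x := by
      refine HasFDerivAt.fun_sum fun γ _ => HasFDerivAt.const_mul ?_ _
      have h2 := ((hφ1.differentiable one_ne_zero) (x - latt (flr 0 x + γ))).hasFDerivAt.comp x
        ((hasFDerivAt_id x).sub_const (latt (flr 0 x + γ)))
      rw [ContinuousLinearMap.comp_id] at h2
      exact h2
    refine h1.congr_of_eventuallyEq ?_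
    filter_upwards [Metric.ball_mem_nhds x one_pos] with y hy
    refine hloc y ?_
    have : y - latt (flr 0 x) = (y - x) + (x - latt (flr 0 x)) := by abel
    rw [this]
    rw [mem_ball_iff_norm] at hy
    exact (norm_add_le _ _).trans (by linarith)
  constructor
  · rw [hloc x (hx1.trans (by norm_num))]
    refine (Finset.abs_sum_le_sum_abs _ _).trans ?_
    refine (Finset.sum_le_card_nsmul _ _ (B * K₀) fun γ _ => ?_).trans ?_
    · rw [abs_mul]
      exact mul_le_mul (hf _) (hK₀ _) (abs_nonneg _) hB
    · rw [nsmul_eq_mul]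
      have : 0 ≤ (Q.card : ℝ) * K₁ * B := by positivity
      linarith
  · rw [hderiv.fderiv]
    refine (norm_sum_le _ _).trans ?_
    refine (Finset.sum_le_card_nsmul _ _ (B * K₁) fun γ _ => ?_).trans ?_
    · rw [norm_smul]
      exact mul_le_mul (hf _) (hK₁ _) (norm_nonneg _) hB
    · rw [nsmul_eq_mul]
      have : 0 ≤ (Q.card : ℝ) * K₀ * B := by positivity
      linarith

theorem exists_smul_near (ℓ : ℕ) (α : ℤ × ℤ) :
    ∃ β₀ : ℤ × ℤ, ‖α - (2 ^ ℓ : ℤ) • β₀‖ ≤ 2 ^ ℓ := by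
  refine ⟨(α.1 / 2 ^ ℓ, α.2 / 2 ^ ℓ), ?_⟩
  have h : ∀ a : ℤ, ‖a - 2 ^ ℓ * (a / 2 ^ ℓ)‖ ≤ 2 ^ ℓ := by
    intro a
    have h2 : (0 : ℤ) < 2 ^ ℓ := by positivity
    have e : a - 2 ^ ℓ * (a / 2 ^ ℓ) = a % 2 ^ ℓ := by rw [Int.emod_def]
    rw [e, Int.norm_eq_abs, abs_of_nonneg (by exact_mod_cast Int.emod_nonneg _ h2.ne')]
    exact_mod_cast (Int.emod_lt_of_pos a h2).le
  simp only [Prod.norm_def, Prod.fst_sub, Prod.snd_sub, Prod.smul_fst, Prod.smul_snd, smul_eq_mul]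
  exact max_le (h _) (h _)

/-- A stationary scheme for which the data `δ` have a limit is stable: the powers of the
subdivision operator are uniformly bounded. -/
theorem exists_power_bound {c : Mask} {R : ℕ} (hR : SuppRadius (fun _ => c) 1 R) {φ : ℝ × ℝ → ℝ}
    (hφ : IsLimit (fun _ => c) 1 delta φ) :
    ∃ K : ℝ, 0 ≤ K ∧ ∀ f B, (∀ α, |f α| ≤ B) →
      ∀ ℓ α, |refineData (fun _ => c) 1 f ℓ α| ≤ K * B := by
  obtain ⟨K₀, hK₀⟩ := hφ.1.bounded_above_of_compact_support (hφ.hasCompactSupport hR)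
  obtain ⟨L, hL⟩ := eventually_atTop.1 (hφ.2 1 one_pos)
  choose b hb using fun ℓ => boundedData_delta.refineData (fun _ => c) 1 ℓ
  have hb0 : ∀ ℓ, 0 ≤ b ℓ := fun ℓ => (abs_nonneg _).trans (hb ℓ 0)
  have hK₀0 : 0 ≤ K₀ := (norm_nonneg _).trans (hK₀ 0)
  set K := ∑ ℓ ∈ Finset.range L, b ℓ + (K₀ + 1) with hK
  have hsum : 0 ≤ ∑ ℓ ∈ Finset.range L, b ℓ := Finset.sum_nonneg fun _ _ => hb0 _
  have hδ : ∀ ℓ α, |refineData (fun _ => c) 1 delta ℓ α| ≤ K := by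
    intro ℓ α
    rcases lt_or_ge ℓ L with h | h
    · have := Finset.single_le_sum (fun i _ => hb0 i) (Finset.mem_range.2 h)
      linarith [hb ℓ α]
    · have h1 := hL ℓ h α
      have h2 := hK₀ ((α.1 : ℝ) / 2 ^ ℓ, (α.2 : ℝ) / 2 ^ ℓ)
      rw [Real.norm_eq_abs] at h2
      rw [abs_le] at h1 h2 ⊢
      constructor <;> linarith
  refine ⟨(lattBall (R + 1)).card * K, by positivity, fun f B hf ℓ α => ?_⟩
  have hB : 0 ≤ B := (abs_nonneg _).trans (hf 0)
  obtain ⟨β₀, hβ₀⟩ := exists_smul_near ℓ α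
  rw [refineData_eq_sum hR f ℓ α ((lattBall (R + 1)).map (addLeftEmbedding β₀)), Finset.sum_map]
  · refine (Finset.abs_sum_le_sum_abs _ _).trans ?_
    refine (Finset.sum_le_card_nsmul _ _ (B * K) fun γ _ => ?_).trans (le_of_eq ?_)
    · rw [abs_mul]
      exact mul_le_mul (hf _) (hδ _ _) (abs_nonneg _) hB
    · rw [nsmul_eq_mul]; ring
  · intro β hβ
    rw [Finset.mem_map]
    refine ⟨β - β₀, mem_lattBall.2 ?_, by simp⟩
    have e : (2 ^ ℓ : ℤ) • (β - β₀) = (α - (2 ^ ℓ : ℤ) • β₀) - (α - (2 ^ ℓ : ℤ) • β) := by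
      rw [smul_sub]; abel
    have h3 := norm_sub_le (α - (2 ^ ℓ : ℤ) • β₀) (α - (2 ^ ℓ : ℤ) • β)
    rw [← e, norm_smul, norm_pow, Int.norm_eq_abs] at h3
    have h2 : (0 : ℝ) < 2 ^ ℓ := by positivity
    have : (0 : ℝ) ≤ R := Nat.cast_nonneg R
    have h4 : |((2 : ℤ) : ℝ)| ^ ℓ = 2 ^ ℓ := by norm_num
    rw [h4] at h3
    refine le_of_mul_le_mul_left ?_ h2
    nlinarith

/-! ### Asymptotically equivalent schemes -/

theorem IsLimit.add {c : ℕ → Mask} {k : ℕ} {f f' : Data} {g g' : ℝ × ℝ → ℝ}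
    (h : IsLimit c k f g) (h' : IsLimit c k f' g') : IsLimit c k (f + f') (g + g') := by
  refine ⟨h.1.add h'.1, fun ε hε => ?_⟩
  filter_upwards [h.2 (ε / 2) (by linarith), h'.2 (ε / 2) (by linarith)] with ℓ h1 h2 α
  rw [refineData_add, Pi.add_apply, Pi.add_apply, add_sub_add_comm]
  exact (abs_add_le _ _).trans (by linarith [h1 α, h2 α])

theorem IsLimit.subdivOp {c : Mask} {f : Data} {g : ℝ × ℝ → ℝ}
    (h : IsLimit (fun _ => c) 1 f g) :
    IsLimit (fun _ => c) 1 (subdivOp c f) fun x => g ((1 / 2 : ℝ) • x) := by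
  refine ⟨h.1.comp (continuous_const_smul _), fun ε hε => ?_⟩
  filter_upwards [(tendsto_add_atTop_nat 1).eventually (h.2 ε hε)] with ℓ h1 α
  have := h1 α
  rw [refineData_const_succ] at this
  have e : (1 / 2 : ℝ) • (((α.1 : ℝ) / 2 ^ ℓ, (α.2 : ℝ) / 2 ^ ℓ) : ℝ × ℝ)
      = ((α.1 : ℝ) / 2 ^ (ℓ + 1), (α.2 : ℝ) / 2 ^ (ℓ + 1)) := by
    ext <;> simp [pow_succ] <;> ring
  simp only [e]
  exact this

/-- All the iterates of the stationary scheme `c` on the data `f` are bounded by `B`. As a norm,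
this is equivalent to the sup-norm if the scheme is stable, and the subdivision operator of `c` is
non-expansive for it. -/
def StableBound (c : Mask) (f : Data) (B : ℝ) : Prop :=
  ∀ ℓ α, |Subdiv.refineData (fun _ => c) 1 f ℓ α| ≤ B

theorem StableBound.add {c : Mask} {f g : Data} {B B' : ℝ} (h : StableBound c f B)
    (h' : StableBound c g B') : StableBound c (f + g) (B + B') := fun ℓ α => by
  rw [refineData_add]
  exact (abs_add_le _ _).trans (add_le_add (h ℓ α) (h' ℓ α))

theorem StableBound.subdivOp {c : Mask} {f : Data} {B : ℝ} (h : StableBound c f B) :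
    StableBound c (subdivOp c f) B := fun ℓ α => by
  rw [← refineData_const_succ]
  exact h (ℓ + 1) α

theorem StableBound.mono {c : Mask} {f : Data} {B B' : ℝ} (h : StableBound c f B) (hB : B ≤ B') :
    StableBound c f B' := fun ℓ α => (h ℓ α).trans hB

/-- The defect `(S_{c^{(k+m)}} - S_c) f^{(k+m)}` of the refinement from level `k + m`. -/
def defect (ck : ℕ → Mask) (c : Mask) (k : ℕ) (f : Data) (m : ℕ) : Data :=
  subdivOp (ck (k + m) - c) (refineData ck k f m)

theorem refineData_succ_eq (ck : ℕ → Mask) (c : Mask) (k : ℕ) (f : Data) (m : ℕ) :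
    refineData ck k f (m + 1) = subdivOp c (refineData ck k f m) + defect ck c k f m := by
  rw [defect, subdivOp_sub_mask, add_sub_cancel]; rfl

section Perturbation

variable {ck : ℕ → Mask} {c : Mask} {K : ℝ}

theorem stableBound_refineData (hK0 : 0 ≤ K)
    (hK : ∀ f B, (∀ α, |f α| ≤ B) → StableBound c f (K * B)) (k : ℕ) {f : Data} {B : ℝ}
    (hf : ∀ α, |f α| ≤ B) (m : ℕ) :
    StableBound c (refineData ck k f m)
      (K * B * Real.exp (K * ∑ i ∈ Finset.range m, opNorm (ck (k + i) - c))) := by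
  induction m with
  | zero => simpa [refineData] using hK f B hf
  | succ m ih =>
    have hB : 0 ≤ B := (abs_nonneg _).trans (hf 0)
    rw [refineData_succ_eq ck c]
    set b := K * B * Real.exp (K * ∑ i ∈ Finset.range m, opNorm (ck (k + i) - c)) with hb
    have h1 : ∀ α, |defect ck c k f m α| ≤ opNorm (ck (k + m) - c) * b :=
      abs_subdivOp_le _ fun α => ih 0 α
    refine (ih.subdivOp.add (hK _ _ h1)).mono ?_
    have hb0 : 0 ≤ b := by positivity
    have e : K * B * Real.exp (K * ∑ i ∈ Finset.range (m + 1), opNorm (ck (k + i) - c))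
        = b * Real.exp (K * opNorm (ck (k + m) - c)) := by
      rw [hb, Finset.sum_range_succ, mul_add, Real.exp_add, ← mul_assoc]
    rw [e]
    nlinarith [Real.add_one_le_exp (K * opNorm (ck (k + m) - c))]

theorem stableBound_refineData_sub (hK : ∀ f B, (∀ α, |f α| ≤ B) → StableBound c f (K * B))
    (k : ℕ) {f : Data} {b : ℝ} (hb : ∀ m α, |refineData ck k f m α| ≤ b) (m j : ℕ) :
    StableBound c (refineData ck k f (m + j) - refineData (fun _ => c) 1 (refineData ck k f m) j)
      (K * b * ∑ i ∈ Finset.range j, opNorm (ck (k + (m + i)) - c)) := by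
  induction j with
  | zero =>
    intro ℓ α
    rw [add_zero, refineData, sub_self, ← refineLin_apply, map_zero]
    simp
  | succ j ih =>
    have e : refineData ck k f (m + (j + 1))
          - refineData (fun _ => c) 1 (refineData ck k f m) (j + 1)
        = subdivOp c (refineData ck k f (m + j)
            - refineData (fun _ => c) 1 (refineData ck k f m) j) + defect ck c k f (m + j) := by
      have h1 : subdivOp c (refineData ck k f (m + j)
            - refineData (fun _ => c) 1 (refineData ck k f m) j)
          = subdivOp c (refineData ck k f (m + j))
            - subdivOp c (refineData (fun _ => c) 1 (refineData ck k f m) j) :=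
        map_sub (subdivLin c) _ _
      rw [h1, ← add_assoc, refineData_succ_eq ck c]
      change _ + _ - subdivOp c _ = _
      abel
    rw [e]
    have h1 : ∀ α, |defect ck c k f (m + j) α| ≤ opNorm (ck (k + (m + j)) - c) * b :=
      abs_subdivOp_le _ (hb _)
    refine (ih.subdivOp.add (hK _ _ h1)).mono (le_of_eq ?_)
    rw [Finset.sum_range_succ]; ring

end Perturbation

/-- The weighted distance `2^j ‖S_{c^{(j)}} - S_c‖_∞` of the level-`j` operators. -/
def weight (ck : ℕ → Mask) (c : Mask) (j : ℕ) : ℝ := 2 ^ j * opNorm (ck j - c)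

theorem weight_nonneg (ck : ℕ → Mask) (c : Mask) (j : ℕ) : 0 ≤ weight ck c j :=
  mul_nonneg (by positivity) (opNorm_nonneg _)

theorem two_pow_mul_opNorm_le (ck : ℕ → Mask) (c : Mask) {k : ℕ} (hk : 1 ≤ k) (m : ℕ) :
    2 ^ (m + 1) * opNorm (ck (k + m) - c) ≤ weight ck c (k + m) := by
  unfold weight
  exact mul_le_mul_of_nonneg_right (pow_le_pow_right₀ (by norm_num) (by lia)) (opNorm_nonneg _)

theorem opNorm_le_weight (ck : ℕ → Mask) (c : Mask) (k : ℕ) :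
    opNorm (ck k - c) ≤ weight ck c k := by
  unfold weight
  have h1 : (1 : ℝ) ≤ 2 ^ k := one_le_pow₀ (by norm_num)
  exact le_mul_of_one_le_left (opNorm_nonneg _) h1

theorem tsum_weight_tendsto (ck : ℕ → Mask) (c : Mask) :
    Tendsto (fun k => ∑' m, weight ck c (k + m)) atTop (𝓝 0) := by
  simpa only [add_comm] using tendsto_sum_nat_add (weight ck c)

/-- A scheme that is asymptotically equivalent of order one to a `C¹`-convergent stationary scheme
has `C¹` limits. The limit `g` is the stationary limit `g₀` plus the sum over `m` of the stationary
limits of the defects at level `m`, dilated by `2^{m+1}`; the weights `2^m` in the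
hypothesis make the sum of the derivatives converge. -/
theorem exists_limit_of_asympEquiv {ck : ℕ → Mask} {c : Mask} (hc : C1Convergent fun _ => c)
    (hw : Summable (weight ck c)) :
    ∃ K : ℝ, ∀ k, 1 ≤ k → ∀ f B, (∀ α, |f α| ≤ B) →
      ∃ g, IsLimit ck k f g ∧ ContDiff ℝ 1 g ∧ ∀ g₀, IsLimit (fun _ => c) 1 f g₀ → ∀ x,
        |g x - g₀ x| ≤ K * B * ∑' m, weight ck c (k + m) ∧
        ‖fderiv ℝ g x - fderiv ℝ g₀ x‖ ≤ K * B * ∑' m, weight ck c (k + m) := by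
  obtain ⟨R, hR'⟩ := exists_suppRadius c.support
  have hR : SuppRadius (fun _ => c) 1 R := fun _ _ α hα => hR' α (Finsupp.mem_support_iff.2 hα)
  obtain ⟨φ, hφ⟩ := hc.1.1 delta boundedData_delta
  obtain ⟨K₁, hK₁0, hK₁⟩ := exists_limit_bound hR hφ (hc.2 _ _ boundedData_delta hφ)
  obtain ⟨K, hK0, hK⟩ := exists_power_bound hR hφ
  set K₂ := K * Real.exp (K * ∑' j, weight ck c j) with hK₂
  have hK₂0 : 0 ≤ K₂ := by positivity
  refine ⟨K₁ * K₂, fun k hk f B hf => ?_⟩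
  have hB : 0 ≤ B := (abs_nonneg _).trans (hf 0)
  have hwk : Summable fun m => weight ck c (k + m) := by
    simpa only [add_comm] using (summable_nat_add_iff k).2 hw
  -- the data at all the levels are uniformly bounded
  have hF : ∀ m α, |refineData ck k f m α| ≤ K₂ * B := by
    intro m α
    refine (stableBound_refineData hK0 hK k hf m 0 α).trans ?_
    have h1 : ∑ i ∈ Finset.range m, opNorm (ck (k + i) - c) ≤ ∑' j, weight ck c j :=
      calc _ ≤ ∑ i ∈ Finset.range m, weight ck c (k + i) :=
            Finset.sum_le_sum fun i _ => opNorm_le_weight ck c (k + i)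
        _ ≤ ∑' i, weight ck c (k + i) :=
            hwk.sum_le_tsum _ fun i _ => weight_nonneg ck c _
        _ ≤ ∑' j, weight ck c j :=
            hwk.tsum_le_tsum_of_inj (fun i => k + i) (add_right_injective k)
              (fun _ _ => weight_nonneg ck c _) (fun _ => le_rfl) hw
    rw [hK₂, mul_right_comm]
    gcongr
  have hFb : ∀ m, BoundedData (refineData ck k f m) := fun m => ⟨_, hF m⟩
  have he : ∀ m α, |defect ck c k f m α| ≤ opNorm (ck (k + m) - c) * (K₂ * B) :=
    fun m => abs_subdivOp_le _ (hF m)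
  choose G hG using fun m => hc.1.1 _ (hFb m)
  choose D hD using fun m => hc.1.1 _ (⟨_, he m⟩ : BoundedData (defect ck c k f m))
  have hGD : ∀ m x, G (m + 1) ((2 : ℝ) ^ (m + 1) • x)
      = G m ((2 : ℝ) ^ m • x) + D m ((2 : ℝ) ^ (m + 1) • x) := by
    intro m x
    have h1 := (hG m).subdivOp.add (hD m)
    rw [← refineData_succ_eq] at h1
    have e : (1 / 2 : ℝ) * 2 ^ (m + 1) = 2 ^ m := by ring
    rw [(hG (m + 1)).unique h1, Pi.add_apply, smul_smul, e]
  set u : ℕ → ℝ := fun m => K₁ * K₂ * B * weight ck c (k + m) with hu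
  have hus : Summable u := hwk.mul_left _
  have hut : ∑' m, u m = K₁ * K₂ * B * ∑' m, weight ck c (k + m) := tsum_mul_left
  have hD0 : ∀ m x, |D m ((2 : ℝ) ^ (m + 1) • x)| ≤ u m := by
    intro m x
    refine (hK₁ _ _ _ (he m) (hD m) _).1.trans ?_
    have := opNorm_le_weight ck c (k + m)
    have h0 : 0 ≤ K₁ * K₂ * B := by positivity
    simp only [hu]
    nlinarith
  have hD1 : ∀ m, ContDiff ℝ 1 (D m) := fun m => hc.2 _ _ ⟨_, he m⟩ (hD m)
  have hDd : ∀ m x, HasFDerivAt (fun x => D m ((2 : ℝ) ^ (m + 1) • x))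
      ((2 : ℝ) ^ (m + 1) • fderiv ℝ (D m) ((2 : ℝ) ^ (m + 1) • x)) x := by
    intro m x
    have h1 := ((hD1 m).differentiable one_ne_zero ((2 : ℝ) ^ (m + 1) • x)).hasFDerivAt
    have h2 := h1.comp x ((hasFDerivAt_id x).const_smul ((2 : ℝ) ^ (m + 1)))
    rw [ContinuousLinearMap.comp_smul, ContinuousLinearMap.comp_id] at h2
    exact h2
  have hD1b : ∀ m x, ‖(2 : ℝ) ^ (m + 1) • fderiv ℝ (D m) ((2 : ℝ) ^ (m + 1) • x)‖ ≤ u m := by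
    intro m x
    have h1 := (hK₁ _ _ _ (he m) (hD m) ((2 : ℝ) ^ (m + 1) • x)).2
    have h2 := two_pow_mul_opNorm_le ck c hk m
    have h0 : 0 ≤ K₁ * K₂ * B := by positivity
    rw [norm_smul, Real.norm_of_nonneg (by positivity)]
    calc _ ≤ (2 : ℝ) ^ (m + 1) * (K₁ * (opNorm (ck (k + m) - c) * (K₂ * B))) := by gcongr
      _ = K₁ * K₂ * B * ((2 : ℝ) ^ (m + 1) * opNorm (ck (k + m) - c)) := by ring
      _ ≤ u m := mul_le_mul_of_nonneg_left h2 h0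
  have hDs : ∀ x, Summable fun m => D m ((2 : ℝ) ^ (m + 1) • x) := fun x =>
    Summable.of_norm_bounded hus fun m => hD0 m x
  set H : ℝ × ℝ → ℝ := fun x => ∑' m, D m ((2 : ℝ) ^ (m + 1) • x) with hH
  have hHd : ∀ x, HasFDerivAt H
      (∑' m, (2 : ℝ) ^ (m + 1) • fderiv ℝ (D m) ((2 : ℝ) ^ (m + 1) • x)) x :=
    hasFDerivAt_tsum hus hDd hD1b (hDs 0)
  have hHfd : fderiv ℝ H
      = fun x => ∑' m, (2 : ℝ) ^ (m + 1) • fderiv ℝ (D m) ((2 : ℝ) ^ (m + 1) • x) :=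
    funext fun x => (hHd x).fderiv
  have hH1 : ContDiff ℝ 1 H := by
    rw [contDiff_one_iff_fderiv]
    refine ⟨fun x => (hHd x).differentiableAt, ?_⟩
    rw [hHfd]
    refine continuous_tsum (fun m => ?_) hus hD1b
    exact Continuous.const_smul (((hD1 m).continuous_fderiv one_ne_zero).comp
      (continuous_const_smul ((2 : ℝ) ^ (m + 1)))) ((2 : ℝ) ^ (m + 1))
  have hG0 : ContDiff ℝ 1 (G 0) := hc.2 _ _ (hFb 0) (hG 0)
  refine ⟨G 0 + H, ⟨(hG0.add hH1).continuous, fun ε hε => ?_⟩, hG0.add hH1, ?_⟩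
  · have hpart : ∀ m x, G m ((2 : ℝ) ^ m • x)
        = G 0 x + ∑ i ∈ Finset.range m, D i ((2 : ℝ) ^ (i + 1) • x) := by
      intro m x
      induction m with
      | zero => simp
      | succ m ih => rw [hGD, ih, Finset.sum_range_succ, add_assoc]
    have htail : ∀ m x, |G 0 x + H x - G m ((2 : ℝ) ^ m • x)| ≤ ∑' i, u (i + m) := by
      intro m x
      rw [hpart, hH]
      simp only
      rw [← (hDs x).sum_add_tsum_nat_add m, add_sub_add_left_eq_sub, add_sub_cancel_left,
        ← Real.norm_eq_abs]
      exact tsum_of_norm_bounded ((summable_nat_add_iff m).2 hus).hasSum fun i => hD0 _ _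
    have hu0 := tendsto_sum_nat_add u
    have hw0 : Tendsto (fun m => K * (K₂ * B) * ∑' i, weight ck c (k + (i + m))) atTop (𝓝 0) := by
      simpa using (tendsto_sum_nat_add fun i => weight ck c (k + i)).const_mul (K * (K₂ * B))
    obtain ⟨m, hm1, hm2⟩ := ((hu0.eventually_le_const (show (0 : ℝ) < ε / 3 by linarith)).and
      (hw0.eventually_le_const (show (0 : ℝ) < ε / 3 by linarith))).exists
    obtain ⟨J, hJ⟩ := eventually_atTop.1 ((hG m).2 (ε / 3) (by linarith))
    refine eventually_atTop.2 ⟨m + J, fun ℓ hℓ α => ?_⟩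
    obtain ⟨j, rfl⟩ := Nat.exists_eq_add_of_le (show m ≤ ℓ by lia)
    have h1 := htail m ((α.1 : ℝ) / 2 ^ (m + j), (α.2 : ℝ) / 2 ^ (m + j))
    have h2 := hJ j (by lia) α
    have e : (2 : ℝ) ^ m • (((α.1 : ℝ) / 2 ^ (m + j), (α.2 : ℝ) / 2 ^ (m + j)) : ℝ × ℝ)
        = ((α.1 : ℝ) / 2 ^ j, (α.2 : ℝ) / 2 ^ j) := by
      ext <;> simp [pow_add] <;> field_simp
    rw [e] at h1
    have h3 := stableBound_refineData_sub hK k hF m j 0 α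
    have h4 : ∑ i ∈ Finset.range j, opNorm (ck (k + (m + i)) - c)
        ≤ ∑' i, weight ck c (k + (i + m)) := by
      refine (Finset.sum_le_sum fun i _ => opNorm_le_weight ck c _).trans ?_
      simp only [add_comm m]
      exact Summable.sum_le_tsum _ (fun i _ => weight_nonneg ck c _)
        ((summable_nat_add_iff m).2 hwk)
    have h5 := mul_le_mul_of_nonneg_left h4 (show 0 ≤ K * (K₂ * B) by positivity)
    simp only [refineData, Pi.sub_apply] at h3
    rw [Pi.add_apply]
    have h6 := h3.trans (h5.trans hm2)
    have h7 := h1.trans hm1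
    rw [abs_le] at h2 h6 h7 ⊢
    constructor <;> linarith
  · intro g₀ hg₀ x
    rw [hg₀.unique (hG 0), ← hut]
    constructor
    · rw [Pi.add_apply, add_sub_cancel_left, ← Real.norm_eq_abs]
      exact tsum_of_norm_bounded hus.hasSum fun i => hD0 _ _
    · rw [fderiv_add (hG0.differentiable one_ne_zero x) (hHd x).differentiableAt,
        add_sub_cancel_left, hHfd]
      exact tsum_of_norm_bounded hus.hasSum fun i => hD1b _ _

/-! ### The spectral splitting of a standard subdivision matrix -/

section PowerBound

variable {ι : Type*} [Fintype ι] [DecidableEq ι]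

attribute [local instance] Matrix.linftyOpNormedRing Matrix.linftyOpNormedAlgebra

theorem norm_entry_le_linfty (B : Matrix ι ι ℂ) (i j : ι) : ‖B i j‖ ≤ ‖B‖ := by
  rw [Matrix.linfty_opNorm_def]
  have h1 : ‖B i j‖₊ ≤ ∑ j, ‖B i j‖₊ :=
    Finset.single_le_sum (f := fun j => ‖B i j‖₊) (fun _ _ => zero_le) (Finset.mem_univ j)
  have h2 := Finset.le_sup (f := fun i => ∑ j, ‖B i j‖₊) (Finset.mem_univ i)
  exact_mod_cast h1.trans h2

/-- If all the eigenvalues have modulus less than `ρ`, then the powers decay like `r ^ k` for some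
`r < ρ`, by Gelfand's formula. -/
theorem exists_pow_entry_bound (B : Matrix ι ι ℂ) {ρ : ℝ} (hρ : 0 < ρ)
    (h : ∀ μ ∈ spectrum ℂ B, ‖μ‖ < ρ) :
    ∃ C r : ℝ, 0 < r ∧ r < ρ ∧ ∀ k i j, ‖(B ^ k) i j‖ ≤ C * r ^ k := by
  rcases isEmpty_or_nonempty ι with hι | hι
  · exact ⟨0, ρ / 2, by linarith, by linarith, fun _ i => hι.elim i⟩
  lift ρ to NNReal using hρ.le
  have h1 : spectralRadius ℂ B < ρ :=
    spectrum.spectralRadius_lt_of_forall_lt B fun z hz => by exact_mod_cast h z hz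
  obtain ⟨r, hr1, hr2⟩ := ENNReal.lt_iff_exists_nnreal_btwn.1 h1
  have hr2' : (r : ℝ) < ρ := by exact_mod_cast hr2
  have hr0 : (0 : ℝ) < r := by
    have : (0 : ENNReal) < r := lt_of_le_of_lt zero_le hr1
    exact_mod_cast this
  have h2 := (spectrum.pow_nnnorm_pow_one_div_tendsto_nhds_spectralRadius B).eventually_lt_const hr1
  obtain ⟨L, hL⟩ := eventually_atTop.1 h2
  have hpow : ∀ k, L + 1 ≤ k → ‖B ^ k‖ ≤ (r : ℝ) ^ k := by
    intro k hk
    have hk0 : (k : ℝ) ≠ 0 := by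
      have : 0 < k := by lia
      exact_mod_cast this.ne'
    have h3 := ENNReal.rpow_le_rpow (hL k (by lia)).le (Nat.cast_nonneg k : (0 : ℝ) ≤ k)
    rw [← ENNReal.rpow_mul, one_div_mul_cancel hk0, ENNReal.rpow_one, ENNReal.rpow_natCast] at h3
    exact_mod_cast h3
  refine ⟨1 + ∑ k ∈ Finset.range (L + 1), ‖B ^ k‖ / (r : ℝ) ^ k, r, hr0, hr2', fun k i j => ?_⟩
  refine (norm_entry_le_linfty _ i j).trans ?_
  have hpos : (0 : ℝ) < (r : ℝ) ^ k := by positivity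
  have hnn : ∀ k, 0 ≤ ‖B ^ k‖ / (r : ℝ) ^ k := fun k => by positivity
  rcases lt_or_ge k (L + 1) with hk | hk
  · have h3 := Finset.single_le_sum (f := fun k => ‖B ^ k‖ / (r : ℝ) ^ k) (fun i _ => hnn i)
      (Finset.mem_range.2 hk)
    rw [← div_le_iff₀ hpos]
    linarith
  · have h3 : 0 ≤ ∑ k ∈ Finset.range (L + 1), ‖B ^ k‖ / (r : ℝ) ^ k :=
      Finset.sum_nonneg fun i _ => hnn i
    refine (hpow k hk).trans ?_
    nlinarith

end PowerBound

section Spectral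

variable {E : ExtraElem} {n p : ℕ} [NeZero n]

/-- The splitting of the space of control data into the eigenspaces of the eigenvalues `1` and `l₁`
and an invariant complement, on which the powers of `S` decay faster than `l₁ ^ k`: the
coordinates `w₀`, `w₁`, `w₂` with respect to the eigenvectors `(1, …, 1)`, `v 0`, `v 1` and the
projection `e` onto the complement. -/
structure Splitting (S : Matrix (Idx E n p) (Idx E n p) ℝ) (l₁ : ℝ)
    (v : Fin 2 → Idx E n p → ℝ) where
  w₀ : (Idx E n p → ℝ) →ₗ[ℝ] ℝ
  w₁ : (Idx E n p → ℝ) →ₗ[ℝ] ℝ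
  w₂ : (Idx E n p → ℝ) →ₗ[ℝ] ℝ
  e : (Idx E n p → ℝ) →ₗ[ℝ] (Idx E n p → ℝ)
  C : ℝ
  r : ℝ
  r_pos : 0 < r
  r_lt : r < l₁
  eq_add : ∀ d, d = (w₀ d • (fun _ => (1 : ℝ)) + w₁ d • v 0 + w₂ d • v 1) + e d
  w₀_mulVec : ∀ d, w₀ (S.mulVec d) = w₀ d
  w₁_mulVec : ∀ d, w₁ (S.mulVec d) = l₁ * w₁ d
  w₂_mulVec : ∀ d, w₂ (S.mulVec d) = l₁ * w₂ d
  e_mulVec : ∀ d, e (S.mulVec d) = S.mulVec (e d)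
  w₁_v₀ : w₁ (v 0) = 1
  w₁_v₁ : w₁ (v 1) = 0
  w₂_v₀ : w₂ (v 0) = 0
  w₂_v₁ : w₂ (v 1) = 1
  pow_le : ∀ k d, ‖(S ^ k).mulVec (e d)‖ ≤ C * r ^ k * ‖d‖

open Polynomial

/-- The characteristic polynomial is `(X - 1) (X - l₁)² h` with pairwise coprime factors; the
Bézout identities give polynomials in `S` that project onto the three invariant subspaces. -/
theorem IsStandard.exists_polynomials {S : Matrix (Idx E n p) (Idx E n p) ℝ} {l₁ : ℝ}
    (hS : IsStandard S l₁) : ∃ e₀ e₁ e₂ : ℝ[X], e₀ + e₁ + e₂ = 1 ∧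
      S.charpoly ∣ (X - C 1) * e₀ ∧ S.charpoly ∣ (X - C l₁) ^ 2 * e₁ ∧
      S.charpoly ∣ e₂ * (e₀ + e₁) ∧ e₀.eval l₁ = 0 ∧ e₂.eval l₁ = 0 ∧ e₂.eval 1 = 0 ∧
      ∀ μ : ℂ, aeval μ S.charpoly = 0 → μ ≠ 1 → μ ≠ l₁ → aeval μ e₂ = 1 := by
  have hP0 : S.charpoly ≠ 0 := (Matrix.charpoly_monic S).ne_zero
  obtain ⟨q, hq, hq1⟩ := exists_eq_pow_rootMultiplicity_mul_and_not_dvd S.charpoly hP0 1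
  rw [hS.one_simple, pow_one] at hq
  have hq0 : q ≠ 0 := fun h => hP0 (by rw [hq, h, mul_zero])
  have hl1 : l₁ ≠ 1 := hS.lt_one.ne
  have hmult : rootMultiplicity l₁ q = 2 := by
    have h := hS.double
    rw [hq, rootMultiplicity_mul (hq ▸ hP0), rootMultiplicity_X_sub_C, if_neg hl1, zero_add] at h
    exact h
  obtain ⟨h, hh, hh1⟩ := exists_eq_pow_rootMultiplicity_mul_and_not_dvd q hq0 l₁
  rw [hmult] at hh
  obtain ⟨a, b, hab⟩ := ((irreducible_X_sub_C (1 : ℝ)).coprime_iff_not_dvd).2 hq1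
  obtain ⟨a', b', hab'⟩ :=
    (((irreducible_X_sub_C l₁).coprime_iff_not_dvd).2 hh1).pow_left (m := 2)
  refine ⟨b * q, a * b' * ((X - C 1) * h), a * a' * ((X - C 1) * (X - C l₁) ^ 2), ?_,
    ⟨b, by rw [hq]; ring⟩, ⟨a * b', by rw [hq, hh]; ring⟩,
    ⟨a * a' * ((X - C l₁) ^ 2 * b + a * b' * (X - C 1)), by rw [hq, hh]; ring⟩, ?_, ?_, ?_, ?_⟩
  · linear_combination hab + a * (X - C 1) * hab'
  · rw [hh]; simp
  · simp
  · simp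
  · intro μ hμ h1 hl
    rw [hq, hh] at hμ
    have h1' : μ - 1 ≠ 0 := sub_ne_zero.2 h1
    have hl' : μ - (l₁ : ℂ) ≠ 0 := sub_ne_zero.2 hl
    have hμ' : aeval μ h = 0 := by simpa [h1', hl'] using hμ
    have e1 := congrArg (aeval μ) hab
    have e2 := congrArg (aeval μ) hab'
    rw [hh] at e1
    simp only [map_add, map_mul, map_pow, map_sub, aeval_X, aeval_C, hμ', mul_zero, add_zero,
      map_one] at e1 e2 ⊢
    linear_combination aeval μ a * (μ - 1) * e2 + e1

theorem IsStandard.nonempty_splitting {S : Matrix (Idx E n p) (Idx E n p) ℝ} {l₁ : ℝ}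
    (hS : IsStandard S l₁) {v : Fin 2 → Idx E n p → ℝ} (hv : LinearIndependent ℝ v)
    (hvS : ∀ j, S.mulVec (v j) = l₁ • v j) : Nonempty (Splitting S l₁ v) := by
  obtain ⟨e₀, e₁, e₂, hsum, hd0, hd1, hd2, h0l, h2l, h21, hμ⟩ := hS.exists_polynomials
  set T : Module.End ℝ (Idx E n p → ℝ) := Matrix.toLin' S with hT
  have hTc : T.charpoly = S.charpoly := Matrix.charpoly_toLin' S
  have hCH : ∀ q : ℝ[X], S.charpoly ∣ q → aeval T q = 0 := by
    rintro q ⟨q', rfl⟩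
    rw [map_mul, ← hTc, LinearMap.aeval_self_charpoly, zero_mul]
  have hTd : ∀ d, S.mulVec d = T d := fun d => (Matrix.toLin'_apply S d).symm
  have hcomm : ∀ (q : ℝ[X]) d, aeval T q (T d) = T (aeval T q d) := by
    intro q d
    have h : aeval T q * T = T * aeval T q := by
      have := congrArg (aeval T) (mul_comm q X)
      simpa only [map_mul, aeval_X] using this
    exact LinearMap.congr_fun h d
  have hnd : Module.finrank ℝ (T.maxGenEigenspace 1) = 1 := by
    rw [LinearMap.finrank_maxGenEigenspace_eq, hTc, hS.one_simple]
  -- the eigenvalue `1`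
  have hT1 : T (fun _ => 1) = fun _ => 1 := by rw [← hTd, hS.mulVec_one]
  obtain ⟨i₀⟩ : Nonempty (Idx E n p) := by
    by_contra hne
    rw [not_nonempty_iff] at hne
    have : Module.finrank ℝ (T.maxGenEigenspace 1) = 0 := Module.finrank_zero_of_subsingleton
    lia
  have hone : (fun _ => 1 : Idx E n p → ℝ) ∈ T.maxGenEigenspace 1 :=
    (T.mem_maxGenEigenspace 1 _).2 ⟨1, by simp [hT1]⟩
  have he0 : ∀ d, aeval T e₀ d = (aeval T e₀ d i₀) • (fun _ => (1 : ℝ)) := by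
    intro d
    have hmem : aeval T e₀ d ∈ T.maxGenEigenspace 1 := by
      refine (T.mem_maxGenEigenspace 1 _).2 ⟨1, ?_⟩
      have h := LinearMap.congr_fun (hCH _ hd0) d
      simpa [Module.algebraMap_end_eq_smul_id] using h
    have hne : (⟨_, hone⟩ : T.maxGenEigenspace 1) ≠ 0 := fun h =>
      one_ne_zero (congrFun (congrArg Subtype.val h) i₀)
    obtain ⟨t, ht⟩ := (finrank_eq_one_iff_of_nonzero' _ hne).1 hnd ⟨_, hmem⟩
    have ht' : t • (fun _ => (1 : ℝ)) = aeval T e₀ d := congrArg Subtype.val ht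
    have h2 := congrFun ht' i₀
    simp only [Pi.smul_apply, smul_eq_mul, mul_one] at h2
    rw [← h2, ht']
  -- the eigenvalue `l₁`
  have hgen : T.eigenspace l₁ = T.maxGenEigenspace l₁ := by
    refine Submodule.eq_of_le_of_finrank_eq (T.eigenspace_le_maxGenEigenspace) ?_
    rw [hS.nondefective, LinearMap.finrank_maxGenEigenspace_eq, hTc, hS.double]
  have he1 : ∀ d, aeval T e₁ d ∈ T.eigenspace l₁ := by
    intro d
    rw [hgen]
    refine (T.mem_maxGenEigenspace l₁ _).2 ⟨2, ?_⟩
    have h := LinearMap.congr_fun (hCH _ hd1) d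
    simpa [Module.algebraMap_end_eq_smul_id, Module.End.one_eq_id] using h
  have hvm : ∀ j, v j ∈ T.eigenspace l₁ := fun j => by
    rw [Module.End.mem_eigenspace_iff, ← hTd, hvS]
  let v' : Fin 2 → T.eigenspace l₁ := fun j => ⟨v j, hvm j⟩
  have hv' : LinearIndependent ℝ v' :=
    LinearIndependent.of_comp (T.eigenspace l₁).subtype hv
  let b := basisOfLinearIndependentOfCardEqFinrank hv' (by rw [hS.nondefective]; rfl)
  have hb : ∀ j, b j = v' j := fun j => by simp [b]
  let P : (Idx E n p → ℝ) →ₗ[ℝ] T.eigenspace l₁ := (aeval T e₁).codRestrict _ he1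
  have hPT : ∀ d, P (T d) = l₁ • P d := fun d => by
    apply Subtype.ext
    change aeval T e₁ (T d) = l₁ • aeval T e₁ d
    rw [hcomm]
    exact Module.End.mem_eigenspace_iff.1 (he1 d)
  have hPv : ∀ j, P (v j) = b j := fun j => by
    rw [hb]
    apply Subtype.ext
    change aeval T e₁ (v j) = v j
    have hev : T.HasEigenvector l₁ (v j) := ⟨hvm j, hv.ne_zero j⟩
    have h1 : e₁.eval l₁ = 1 := by
      have := congrArg (eval l₁) hsum
      simpa [h0l, h2l] using this
    rw [Module.End.aeval_apply_of_hasEigenvector hev, h1, one_smul]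
  -- the complement
  set A := aeval S e₂ with hA
  have hAT : ∀ d, aeval T e₂ d = A.mulVec d := by
    intro d
    have h : aeval T e₂ = Matrix.toLinAlgEquiv' A :=
      aeval_algHom_apply (Matrix.toLinAlgEquiv' (R := ℝ) (n := Idx E n p)) S e₂
    rw [h]; rfl
  have hAA : A * A = A := by
    have h1 : aeval S (e₂ * (e₀ + e₁)) = 0 := by
      obtain ⟨q', hq'⟩ := hd2
      rw [hq', map_mul, Matrix.aeval_self_charpoly, zero_mul]
    have h2 : e₂ * e₂ = e₂ - e₂ * (e₀ + e₁) := by linear_combination e₂ * hsum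
    rw [hA, ← map_mul, h2, map_sub, h1, sub_zero]
  have hSA : Commute S A := by
    have h := congrArg (aeval S) (mul_comm X e₂)
    rw [map_mul, map_mul, aeval_X] at h
    exact h
  have hpow : ∀ k, S ^ k * A = (S * A) ^ k * A := by
    intro k
    rw [hSA.mul_pow, mul_assoc, ← pow_succ, IsIdempotentElem.pow_succ_eq k hAA]
  let f : ℝ →+* ℂ := algebraMap ℝ ℂ
  have : Nonempty (Idx E n p) := ⟨i₀⟩
  have hspec : ∀ μ ∈ spectrum ℂ ((S * A).map f), ‖μ‖ < l₁ := by
    have hmap : (S * A).map f = aeval (S.map f) ((X * e₂).map f) := by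
      have h1 : S * A = aeval S (X * e₂) := by rw [map_mul, aeval_X]
      rw [h1, aeval_map_algebraMap ℂ (S.map f) (X * e₂)]
      exact (aeval_algHom_apply (Complex.ofRealAm.mapMatrix (m := Idx E n p)) S (X * e₂)).symm
    intro μ hμs
    have hne : (spectrum ℂ (S.map f)).Nonempty :=
      spectrum.nonempty_of_isAlgClosed_of_finiteDimensional ℂ _
    rw [hmap, spectrum.map_polynomial_aeval_of_nonempty _ _ hne] at hμs
    obtain ⟨z, hz, rfl⟩ := hμs
    rw [Matrix.mem_spectrum_iff_isRoot_charpoly, Matrix.charpoly_map] at hz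
    have hz' : aeval z S.charpoly = 0 := by
      rw [aeval_def, ← eval_map]; exact hz
    have hval : eval z ((X * e₂).map f) = z * aeval z e₂ := by
      rw [eval_map, eval₂_mul, eval₂_X]; rfl
    simp only [hval]
    by_cases h1 : z = 1
    · have : aeval z e₂ = 0 := by
        have h2 := aeval_algebraMap_apply ℂ (1 : ℝ) e₂
        rw [coe_aeval_eq_eval, h21, map_zero, map_one] at h2
        rw [h1, h2]
      rw [this, mul_zero, norm_zero]; exact hS.pos
    by_cases h2 : z = l₁
    · have : aeval z e₂ = 0 := by
        have h3 := aeval_algebraMap_apply ℂ l₁ e₂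
        rw [coe_aeval_eq_eval, h2l, map_zero] at h3
        rw [h2]; exact h3
      rw [this, mul_zero, norm_zero]; exact hS.pos
    rw [hμ z hz' h1 h2, mul_one]
    exact hS.others z hz' h1 h2
  obtain ⟨K, r, hr0, hr1, hK⟩ := exists_pow_entry_bound _ hS.pos hspec
  have hK' : ∀ k i j, |((S * A) ^ k) i j| ≤ K * r ^ k := by
    intro k i j
    have h := hK k i j
    have e : ((S * A).map f) ^ k = ((S * A) ^ k).map f := (map_pow f.mapMatrix (S * A) k).symm
    rw [e, Matrix.map_apply] at h
    simpa [f] using h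
  have hK0 : 0 ≤ K := by simpa using (abs_nonneg _).trans (hK' 0 i₀ i₀)
  obtain ⟨M, hM⟩ : ∃ M, ∀ d, ‖aeval T e₂ d‖ ≤ M * ‖d‖ :=
    ⟨_, fun d => (LinearMap.toContinuousLinearMap (aeval T e₂)).le_opNorm d⟩
  refine ⟨{
    w₀ := LinearMap.proj i₀ ∘ₗ aeval T e₀
    w₁ := b.coord 0 ∘ₗ P
    w₂ := b.coord 1 ∘ₗ P
    e := aeval T e₂
    C := Fintype.card (Idx E n p) * K * M
    r := r
    r_pos := hr0
    r_lt := hr1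
    eq_add := ?_
    w₀_mulVec := ?_
    w₁_mulVec := ?_
    w₂_mulVec := ?_
    e_mulVec := ?_
    w₁_v₀ := ?_
    w₁_v₁ := ?_
    w₂_v₀ := ?_
    w₂_v₁ := ?_
    pow_le := ?_ }⟩
  · intro d
    have h1 : (P d : Idx E n p → ℝ) = b.coord 0 (P d) • v 0 + b.coord 1 (P d) • v 1 := by
      have h := congrArg Subtype.val (b.sum_repr (P d)).symm
      rw [Fin.sum_univ_two, hb, hb] at h
      exact h
    have h2 : d = aeval T e₀ d + aeval T e₁ d + aeval T e₂ d := by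
      have h := LinearMap.congr_fun (congrArg (aeval T) hsum) d
      simpa using h.symm
    have h3 : aeval T e₁ d = b.coord 0 (P d) • v 0 + b.coord 1 (P d) • v 1 := h1
    rw [he0 d, h3, ← add_assoc] at h2
    exact h2
  · intro d
    have h : aeval T e₀ (T d) = aeval T e₀ d := by
      rw [hcomm, he0 d, map_smul, hT1]
    rw [hTd]
    exact congrFun h i₀
  · intro d
    rw [hTd, LinearMap.comp_apply, hPT, map_smul]; rfl
  · intro d
    rw [hTd, LinearMap.comp_apply, hPT, map_smul]; rfl
  · intro d
    rw [hTd, hTd, hcomm]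
  · simp [hPv]
  · simp [hPv]
  · simp [hPv]
  · simp [hPv]
  · intro k d
    have e : (S ^ k).mulVec (aeval T e₂ d) = ((S * A) ^ k).mulVec (aeval T e₂ d) := by
      rw [hAT, Matrix.mulVec_mulVec, Matrix.mulVec_mulVec, hpow]
    rw [e]
    have hpos : 0 ≤ K * r ^ k := by positivity
    refine (pi_norm_le_iff_of_nonneg ?_).2 fun i => ?_
    · have := (norm_nonneg _).trans (hM d)
      have h2 : (Fintype.card (Idx E n p) : ℝ) * K * M * r ^ k * ‖d‖
        = Fintype.card (Idx E n p) * (K * r ^ k) * (M * ‖d‖) := by ring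
      rw [h2]; positivity
    · refine (norm_sum_le _ _).trans ?_
      refine (Finset.sum_le_card_nsmul _ _ (K * r ^ k * (M * ‖d‖)) fun j _ => ?_).trans
        (le_of_eq ?_)
      · rw [norm_mul]
        exact mul_le_mul (hK' k i j) ((norm_le_pi_norm _ j).trans (hM d)) (norm_nonneg _) hpos
      · rw [nsmul_eq_mul, Finset.card_univ]; ring

end Spectral

/-! ### Asymptotics of the control points -/

section ControlPoints

variable {E : ExtraElem} {n p : ℕ} [NeZero n]

theorem rowSumNorm_nonneg (M : Matrix (Idx E n p) (Idx E n p) ℝ) : 0 ≤ rowSumNorm M :=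
  Real.iSup_nonneg fun _ => Finset.sum_nonneg fun _ _ => abs_nonneg _

theorem norm_mulVec_le_rowSumNorm (M : Matrix (Idx E n p) (Idx E n p) ℝ) (d : Idx E n p → ℝ) :
    ‖M.mulVec d‖ ≤ rowSumNorm M * ‖d‖ := by
  refine (pi_norm_le_iff_of_nonneg (mul_nonneg (rowSumNorm_nonneg M) (norm_nonneg d))).2
    fun a => ?_
  have h1 : ∑ b, |M a b| ≤ rowSumNorm M :=
    le_ciSup (f := fun a => ∑ b, |M a b|) (Set.finite_range _).bddAbove a
  calc ‖M.mulVec d a‖ ≤ ∑ b, ‖M a b * d b‖ := norm_sum_le _ _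
    _ ≤ ∑ b, |M a b| * ‖d‖ := by
        gcongr with b _
        rw [norm_mul]
        exact mul_le_mul_of_nonneg_left (norm_le_pi_norm d b) (abs_nonneg _)
    _ = (∑ b, |M a b|) * ‖d‖ := by rw [Finset.sum_mul]
    _ ≤ rowSumNorm M * ‖d‖ := mul_le_mul_of_nonneg_right h1 (norm_nonneg d)

/-- One coordinate of the control points after `m` steps that start at level `k`. -/
def iterVec (M : ℕ → Matrix (Idx E n p) (Idx E n p) ℝ) (k : ℕ) (d : Idx E n p → ℝ) :
    ℕ → Idx E n p → ℝ
  | 0 => d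
  | m + 1 => (M (k + m)).mulVec (iterVec M k d m)

variable {M : ℕ → Matrix (Idx E n p) (Idx E n p) ℝ} {S : Matrix (Idx E n p) (Idx E n p) ℝ}
  {l₁ : ℝ} {v : Fin 2 → Idx E n p → ℝ} {C τ : ℝ}

theorem controlPoints_succ (M : ℕ → Matrix (Idx E n p) (Idx E n p) ℝ)
    (D : Idx E n p → Fin 3 → ℝ) (m : ℕ) (a : Idx E n p) (j : Fin 3) :
    controlPoints M D (m + 1) a j = iterVec M 1 (fun a => D a j) m a := by
  induction m generalizing a with
  | zero => rfl
  | succ m ih =>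
    simp only [controlPoints, iterVec, Matrix.mulVec, dotProduct, Finset.sum_apply, Pi.smul_apply,
      smul_eq_mul, ih, add_comm 1 m]

theorem iterVec_add (M : ℕ → Matrix (Idx E n p) (Idx E n p) ℝ) (k : ℕ) (d : Idx E n p → ℝ)
    (m j : ℕ) : iterVec M k d (m + j) = iterVec M (k + m) (iterVec M k d m) j := by
  induction j with
  | zero => rfl
  | succ j ih => rw [← add_assoc, iterVec, ih, iterVec, add_assoc]

theorem iterVec_succ_eq (M : ℕ → Matrix (Idx E n p) (Idx E n p) ℝ)
    (S : Matrix (Idx E n p) (Idx E n p) ℝ) (k : ℕ) (d : Idx E n p → ℝ) (m : ℕ) :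
    iterVec M k d (m + 1)
      = S.mulVec (iterVec M k d m) + (M (k + m) - S).mulVec (iterVec M k d m) := by
  rw [← Matrix.add_mulVec, add_sub_cancel]; rfl

theorem iterVec_map_add (M : ℕ → Matrix (Idx E n p) (Idx E n p) ℝ) (k : ℕ)
    (d d' : Idx E n p → ℝ) (m : ℕ) :
    iterVec M k (d + d') m = iterVec M k d m + iterVec M k d' m := by
  induction m with
  | zero => rfl
  | succ m ih => rw [iterVec, ih, Matrix.mulVec_add]; rfl

theorem iterVec_map_smul (M : ℕ → Matrix (Idx E n p) (Idx E n p) ℝ) (k : ℕ)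
    (t : ℝ) (d : Idx E n p → ℝ) (m : ℕ) :
    iterVec M k (t • d) m = t • iterVec M k d m := by
  induction m with
  | zero => rfl
  | succ m ih => rw [iterVec, ih, Matrix.mulVec_smul]; rfl

theorem exists_functional_bound (w : (Idx E n p → ℝ) →ₗ[ℝ] ℝ) :
    ∃ K : ℝ, 0 ≤ K ∧ ∀ d, |w d| ≤ K * ‖d‖ :=
  ⟨_, norm_nonneg _, fun d => (LinearMap.toContinuousLinearMap w).le_opNorm d⟩

theorem pow_mulVec_eigenvector {x : Idx E n p → ℝ} {μ : ℝ} (h : S.mulVec x = μ • x) (k : ℕ) :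
    (S ^ k).mulVec x = μ ^ k • x := by
  induction k with
  | zero => simp
  | succ k ih => rw [pow_succ, ← Matrix.mulVec_mulVec, h, Matrix.mulVec_smul, ih, smul_smul,
      pow_succ']

theorem Splitting.exists_pow_bound (sp : Splitting S l₁ v) (hS : IsStandard S l₁)
    (hvS : ∀ j, S.mulVec (v j) = l₁ • v j) :
    ∃ K : ℝ, 0 ≤ K ∧ ∀ k d, ‖(S ^ k).mulVec d‖ ≤ K * ‖d‖ := by
  obtain ⟨K₀, hK₀0, hK₀⟩ := exists_functional_bound sp.w₀
  obtain ⟨K₁, hK₁0, hK₁⟩ := exists_functional_bound sp.w₁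
  obtain ⟨K₂, hK₂0, hK₂⟩ := exists_functional_bound sp.w₂
  refine ⟨K₀ * 1 + K₁ * ‖v 0‖ + K₂ * ‖v 1‖ + |sp.C|, by positivity, fun k d => ?_⟩
  have h1 : (S ^ k).mulVec (fun _ => (1 : ℝ)) = fun _ => 1 := by
    simpa using pow_mulVec_eigenvector (μ := 1) (by rw [hS.mulVec_one, one_smul]) k
  have hl : l₁ ^ k ≤ 1 := pow_le_one₀ hS.pos.le hS.lt_one.le
  have hl0 : 0 ≤ l₁ ^ k := pow_nonneg hS.pos.le k
  have hv : ∀ j, ‖(S ^ k).mulVec (v j)‖ ≤ ‖v j‖ := fun j => by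
    rw [pow_mulVec_eigenvector (hvS j), norm_smul, Real.norm_of_nonneg hl0]
    exact mul_le_of_le_one_left (norm_nonneg _) hl
  have hone : ‖(fun _ => 1 : Idx E n p → ℝ)‖ ≤ 1 :=
    (pi_norm_le_iff_of_nonneg zero_le_one).2 fun _ => by simp
  have he : ‖(S ^ k).mulVec (sp.e d)‖ ≤ |sp.C| * ‖d‖ := by
    refine (sp.pow_le k d).trans (mul_le_mul_of_nonneg_right ?_ (norm_nonneg d))
    have hr : sp.r ^ k ≤ 1 := pow_le_one₀ sp.r_pos.le (sp.r_lt.trans hS.lt_one).le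
    have hr0 : 0 ≤ sp.r ^ k := pow_nonneg sp.r_pos.le k
    nlinarith [le_abs_self sp.C, abs_nonneg sp.C]
  conv_lhs => rw [sp.eq_add d]
  rw [Matrix.mulVec_add, Matrix.mulVec_add, Matrix.mulVec_add, Matrix.mulVec_smul,
    Matrix.mulVec_smul, Matrix.mulVec_smul, h1]
  calc _ ≤ ‖sp.w₀ d • (fun _ => 1 : Idx E n p → ℝ)‖ + ‖sp.w₁ d • (S ^ k).mulVec (v 0)‖
        + ‖sp.w₂ d • (S ^ k).mulVec (v 1)‖ + ‖(S ^ k).mulVec (sp.e d)‖ :=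
        (norm_add_le _ _).trans (add_le_add_left
          ((norm_add_le _ _).trans (add_le_add_left (norm_add_le _ _) _)) _)
    _ ≤ (K₀ * ‖d‖) * 1 + (K₁ * ‖d‖) * ‖v 0‖ + (K₂ * ‖d‖) * ‖v 1‖ + |sp.C| * ‖d‖ := by
        rw [norm_smul, norm_smul, norm_smul]
        gcongr
        · exact hK₀ d
        · exact hK₁ d
        · exact hv 0
        · exact hK₂ d
        · exact hv 1
    _ = _ := by ring

/-- The matrices `M k` approach `S` at the geometric rate `τ`. -/
def GeomClose (M : ℕ → Matrix (Idx E n p) (Idx E n p) ℝ) (S : Matrix (Idx E n p) (Idx E n p) ℝ)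
    (C τ : ℝ) : Prop :=
  ∀ k, 1 ≤ k → ∀ d, ‖(M k - S).mulVec d‖ ≤ C * τ ^ k * ‖d‖

theorem exists_iterVec_bound {K : ℝ} (hK0 : 0 ≤ K) (hK : ∀ k d, ‖(S ^ k).mulVec d‖ ≤ K * ‖d‖)
    (hC : 0 ≤ C) (hτ0 : 0 < τ) (hτ1 : τ < 1) (hM : GeomClose M S C τ) :
    ∃ B : ℝ, 0 ≤ B ∧ ∀ k, 1 ≤ k → ∀ d m, ‖iterVec M k d m‖ ≤ B * ‖d‖ := by
  have key : ∀ k, 1 ≤ k → ∀ d m j, ‖(S ^ j).mulVec (iterVec M k d m)‖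
      ≤ K * ‖d‖ * Real.exp (K * ∑ i ∈ Finset.range m, C * τ ^ i) := by
    intro k hk d m
    induction m with
    | zero => intro j; simpa [iterVec] using hK j d
    | succ m ih =>
      intro j
      set b := K * ‖d‖ * Real.exp (K * ∑ i ∈ Finset.range m, C * τ ^ i) with hb
      have hb0 : 0 ≤ b := by positivity
      have hx : ‖iterVec M k d m‖ ≤ b := by simpa using ih 0
      have h1 : ‖(M (k + m) - S).mulVec (iterVec M k d m)‖ ≤ C * τ ^ m * b := by
        refine (hM (k + m) (by lia) _).trans ?_
        have : τ ^ (k + m) ≤ τ ^ m := pow_le_pow_of_le_one hτ0.le hτ1.le (by lia)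
        gcongr
      have e : K * ‖d‖ * Real.exp (K * ∑ i ∈ Finset.range (m + 1), C * τ ^ i)
          = b * Real.exp (K * (C * τ ^ m)) := by
        rw [hb, Finset.sum_range_succ, mul_add, Real.exp_add, ← mul_assoc]
      have h2 : (S ^ j).mulVec (S.mulVec (iterVec M k d m))
          = (S ^ (j + 1)).mulVec (iterVec M k d m) := by
        rw [Matrix.mulVec_mulVec, pow_succ]
      rw [e, iterVec_succ_eq M S, Matrix.mulVec_add, h2]
      calc _ ≤ b + K * (C * τ ^ m * b) := (norm_add_le _ _).trans (add_le_add (ih (j + 1))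
            ((hK _ _).trans (mul_le_mul_of_nonneg_left h1 hK0)))
        _ = b * (K * (C * τ ^ m) + 1) := by ring
        _ ≤ b * Real.exp (K * (C * τ ^ m)) :=
            mul_le_mul_of_nonneg_left (Real.add_one_le_exp _) hb0
  refine ⟨K * Real.exp (K * (C * (1 - τ)⁻¹)), by positivity, fun k hk d m => ?_⟩
  have h := key k hk d m 0
  rw [pow_zero, Matrix.one_mulVec] at h
  refine h.trans ?_
  rw [mul_right_comm]
  gcongr
  rw [← Finset.mul_sum]
  gcongr
  rw [← tsum_geometric_of_lt_one hτ0.le hτ1]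
  exact (summable_geometric_of_lt_one hτ0.le hτ1).sum_le_tsum _ fun i _ => by positivity

/-- A left eigenvector `w` of `S` for an eigenvalue `μ > τ` has a non-stationary counterpart for
each starting level `k`: the limit of `μ ^ (-m) w (d_{k+m})`. It approaches `w` as `k → ∞`. -/
theorem exists_limit_functional {w : (Idx E n p → ℝ) →ₗ[ℝ] ℝ} {μ : ℝ} (hμ : 0 < μ)
    (hw : ∀ d, w (S.mulVec d) = μ * w d) (hC : 0 ≤ C) (hτ0 : 0 < τ) (hτμ : τ < μ)
    (hM : GeomClose M S C τ) {B : ℝ}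
    (hB : ∀ k, 1 ≤ k → ∀ d m, ‖iterVec M k d m‖ ≤ B * ‖d‖) :
    ∃ (L : ℕ → (Idx E n p → ℝ) →ₗ[ℝ] ℝ) (K : ℝ), ∀ k, 1 ≤ k → ∀ d,
      Tendsto (fun m => w (iterVec M k d m) / μ ^ m) atTop (𝓝 (L k d)) ∧
      |L k d - w d| ≤ K * τ ^ k * ‖d‖ := by
  obtain ⟨K, hK0, hK⟩ := exists_functional_bound w
  have hr : τ / μ < 1 := (div_lt_one hμ).2 hτμ
  have hstep : ∀ k, 1 ≤ k → ∀ d m,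
      dist (w (iterVec M k d m) / μ ^ m) (w (iterVec M k d (m + 1)) / μ ^ (m + 1))
        ≤ (K * C * B / μ * τ ^ k * ‖d‖) * (τ / μ) ^ m := by
    intro k hk d m
    have h1 : ‖(M (k + m) - S).mulVec (iterVec M k d m)‖ ≤ C * τ ^ (k + m) * (B * ‖d‖) :=
      (hM (k + m) (by lia) _).trans (mul_le_mul_of_nonneg_left (hB k hk d m) (by positivity))
    have h2 := (hK _).trans (mul_le_mul_of_nonneg_left h1 hK0)
    have e : w (iterVec M k d m) / μ ^ m - w (iterVec M k d (m + 1)) / μ ^ (m + 1)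
        = -(w ((M (k + m) - S).mulVec (iterVec M k d m)) / μ ^ (m + 1)) := by
      rw [iterVec_succ_eq M S, map_add, hw, pow_succ]
      field_simp
      ring
    rw [Real.dist_eq, e, abs_neg, abs_div, abs_of_pos (pow_pos hμ _), div_le_iff₀ (pow_pos hμ _)]
    refine h2.trans (le_of_eq ?_)
    rw [pow_add, pow_succ, div_pow]
    field_simp
  have hlim : ∀ k d, ∃ a, 1 ≤ k → Tendsto (fun m => w (iterVec M k d m) / μ ^ m) atTop (𝓝 a) := by
    intro k d
    by_cases hk : 1 ≤ k
    · obtain ⟨a, ha⟩ :=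
        cauchySeq_tendsto_of_complete (cauchySeq_of_le_geometric _ _ hr (hstep k hk d))
      exact ⟨a, fun _ => ha⟩
    · exact ⟨0, fun h => absurd h hk⟩
  choose L hL using hlim
  let L' : ℕ → (Idx E n p → ℝ) →ₗ[ℝ] ℝ := fun k =>
    if hk : 1 ≤ k then
      { toFun := L k
        map_add' := fun d d' => by
          refine tendsto_nhds_unique (hL k (d + d') hk) (((hL k d hk).add (hL k d' hk)).congr ?_)
          intro m
          rw [iterVec_map_add, map_add, add_div]
        map_smul' := fun t d => by
          refine tendsto_nhds_unique (hL k (t • d) hk) (((hL k d hk).const_mul t).congr ?_)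
          intro m
          rw [iterVec_map_smul, map_smul, smul_eq_mul, mul_div_assoc] }
    else 0
  have hL' : ∀ k, 1 ≤ k → ∀ d, L' k d = L k d := fun k hk d => by simp [L', hk]
  refine ⟨L', K * C * B / μ / (1 - τ / μ), fun k hk d => ?_⟩
  rw [hL' k hk d]
  refine ⟨hL k d hk, ?_⟩
  have h := dist_le_of_le_geometric_of_tendsto₀ _ _ hr (hstep k hk d) (hL k d hk)
  rw [pow_zero, div_one, dist_comm, Real.dist_eq] at h
  refine h.trans (le_of_eq ?_)
  ring

/-- On the complement of the eigenspaces of `1` and `l₁` the control points are `o(l₁ ^ m)`. -/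
theorem Splitting.tendsto_e (sp : Splitting S l₁ v) (hl : 0 < l₁) (hC : 0 ≤ C) (hτ0 : 0 < τ)
    (hτ1 : τ < 1) (hτl : τ < l₁) (hM : GeomClose M S C τ) {B : ℝ} (hB0 : 0 ≤ B)
    (hB : ∀ k, 1 ≤ k → ∀ d m, ‖iterVec M k d m‖ ≤ B * ‖d‖) (d : Idx E n p → ℝ) :
    Tendsto (fun m => (l₁ ^ m)⁻¹ • sp.e (iterVec M 1 d m)) atTop (𝓝 0) := by
  obtain ⟨ρ, hρ1, hρ2⟩ := exists_between (max_lt sp.r_lt hτl)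
  rw [max_lt_iff] at hρ1
  have hρ0 : 0 < ρ := hτ0.trans hρ1.2
  set c := |sp.C| * (C * (B * ‖d‖)) with hc
  have hc0 : 0 ≤ c := by positivity
  set D := |sp.C| * ‖d‖ + c / (ρ - sp.r) with hD
  have hρr : 0 < ρ - sp.r := sub_pos.2 hρ1.1
  have hcD : c ≤ D * (ρ - sp.r) := by
    rw [← div_le_iff₀ hρr, hD]
    have : 0 ≤ |sp.C| * ‖d‖ := by positivity
    linarith
  -- the bounds `D ρ ^ m r ^ j` are stable under one more step since `r < ρ` and `τ < ρ`
  have key : ∀ m j, ‖(S ^ j).mulVec (sp.e (iterVec M 1 d m))‖ ≤ D * ρ ^ m * sp.r ^ j := by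
    intro m
    induction m with
    | zero =>
      intro j
      refine (sp.pow_le j d).trans ?_
      have h0 : 0 ≤ sp.r ^ j := pow_nonneg sp.r_pos.le j
      have h1 : |sp.C| * ‖d‖ ≤ D := le_add_of_nonneg_right (by positivity)
      have h2 : sp.C * ‖d‖ ≤ D :=
        (mul_le_mul_of_nonneg_right (le_abs_self _) (norm_nonneg d)).trans h1
      rw [pow_zero, mul_one, mul_right_comm]
      exact mul_le_mul_of_nonneg_right h2 h0
    | succ m ih =>
      intro j
      have h0 : 0 ≤ sp.r ^ j := pow_nonneg sp.r_pos.le j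
      have h1 : ‖(M (1 + m) - S).mulVec (iterVec M 1 d m)‖ ≤ C * ρ ^ m * (B * ‖d‖) := by
        refine (hM (1 + m) (by lia) _).trans ?_
        have h2 : τ ^ (1 + m) ≤ ρ ^ m := by
          rw [add_comm, pow_succ]
          exact (mul_le_of_le_one_right (by positivity) hτ1.le).trans
            (pow_le_pow_left₀ hτ0.le hρ1.2.le m)
        have := hB 1 le_rfl d m
        gcongr
      have h2 := (sp.pow_le j ((M (1 + m) - S).mulVec (iterVec M 1 d m))).trans
        (mul_le_mul (mul_le_mul_of_nonneg_right (le_abs_self sp.C) h0) h1 (norm_nonneg _)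
          (by positivity))
      have h3 := ih (j + 1)
      have h4 : (S ^ j).mulVec (S.mulVec (sp.e (iterVec M 1 d m)))
          = (S ^ (j + 1)).mulVec (sp.e (iterVec M 1 d m)) := by
        rw [Matrix.mulVec_mulVec, pow_succ]
      rw [iterVec_succ_eq M S, map_add, sp.e_mulVec, Matrix.mulVec_add, h4]
      refine (norm_add_le _ _).trans ((add_le_add h3 h2).trans ?_)
      have h5 : |sp.C| * sp.r ^ j * (C * ρ ^ m * (B * ‖d‖)) = c * (ρ ^ m * sp.r ^ j) := by
        rw [hc]; ring
      have h6 := mul_le_mul_of_nonneg_right hcD (show 0 ≤ ρ ^ m * sp.r ^ j by positivity)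
      rw [h5, pow_succ, pow_succ]
      linarith
  have hlim : Tendsto (fun m : ℕ => D * (ρ / l₁) ^ m) atTop (𝓝 0) := by
    simpa using (tendsto_pow_atTop_nhds_zero_of_lt_one (div_pos hρ0 hl).le
      ((div_lt_one hl).2 hρ2)).const_mul D
  refine squeeze_zero_norm (fun m => ?_) hlim
  have h := key m 0
  rw [pow_zero, Matrix.one_mulVec, pow_zero, mul_one] at h
  rw [norm_smul, norm_inv, Real.norm_of_nonneg (pow_pos hl m).le, div_pow, inv_mul_le_iff₀
    (pow_pos hl m)]
  refine h.trans (le_of_eq ?_)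
  field_simp

/-! ### Non-degeneracy of the limits -/

/-- If the non-vanishing columns of the matrices form invertible blocks, then the control points
of the set `A` at a later level can be prescribed. -/
theorem exists_iterVec_eq {A : Finset (Idx E n p)}
    (hA : ∀ k, 1 ≤ k → ∀ a b, b ∉ A → M k a b = 0)
    (hdet : ∀ k, 1 ≤ k →
      ((M k).submatrix (fun a : A => (a : Idx E n p)) (fun a : A => a)).det ≠ 0)
    (m : ℕ) (y : Idx E n p → ℝ) : ∃ d, ∀ a ∈ A, iterVec M 1 d m a = y a := by
  induction m generalizing y with
  | zero => exact ⟨y, fun _ _ => rfl⟩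
  | succ m ih =>
    set N := (M (1 + m)).submatrix (fun a : A => (a : Idx E n p)) (fun a : A => a) with hN
    have hu : IsUnit N.det := (hdet (1 + m) (by lia)).isUnit
    set z : A → ℝ := N⁻¹.mulVec (fun a : A => y a) with hz
    have hNz : N.mulVec z = fun a : A => y a := by
      rw [hz, Matrix.mulVec_mulVec, Matrix.mul_nonsing_inv N hu, Matrix.one_mulVec]
    obtain ⟨d, hd⟩ := ih fun a => if h : a ∈ A then z ⟨a, h⟩ else 0
    refine ⟨d, fun a ha => ?_⟩
    have h1 : ∑ b, M (1 + m) a b * iterVec M 1 d m b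
        = ∑ b ∈ A, M (1 + m) a b * iterVec M 1 d m b :=
      (Finset.sum_subset (Finset.subset_univ A) fun b _ hb => by
        rw [hA (1 + m) (by lia) a b hb, zero_mul]).symm
    change ∑ b, M (1 + m) a b * iterVec M 1 d m b = y a
    rw [h1, ← congrFun hNz ⟨a, ha⟩, ← Finset.sum_coe_sort]
    refine Finset.sum_congr rfl fun b _ => ?_
    rw [hd b b.2, dif_pos b.2]; rfl

/-- For a non-singular scheme the limit functional at level `1` of a left eigenvector is zero
only if the eigenvector is zero: otherwise the functionals at all the later levels
would vanish, and they approach the eigenvector. -/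
theorem eq_zero_of_limit_functional_eq_zero (hns : NonSingularLocal M)
    {w : (Idx E n p → ℝ) →ₗ[ℝ] ℝ} {μ : ℝ} (hμ : 0 < μ) (hτ0 : 0 < τ) (hτ1 : τ < 1)
    {L : ℕ → (Idx E n p → ℝ) →ₗ[ℝ] ℝ} {K : ℝ}
    (hL : ∀ k, 1 ≤ k → ∀ d,
      Tendsto (fun m => w (iterVec M k d m) / μ ^ m) atTop (𝓝 (L k d)) ∧
      |L k d - w d| ≤ K * τ ^ k * ‖d‖)
    (h0 : ∀ d, L 1 d = 0) (y : Idx E n p → ℝ) : w y = 0 := by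
  obtain ⟨A, hA, hdet⟩ := hns
  have hLy : ∀ m, L (1 + m) y = 0 := by
    intro m
    obtain ⟨d, hd⟩ := exists_iterVec_eq hA hdet m y
    have hcongr : ∀ j, iterVec M (1 + m) (iterVec M 1 d m) (j + 1)
        = iterVec M (1 + m) y (j + 1) := by
      intro j
      induction j with
      | zero =>
        funext a
        change ∑ b, M (1 + m) a b * iterVec M 1 d m b = ∑ b, M (1 + m) a b * y b
        refine Finset.sum_congr rfl fun b _ => ?_
        by_cases hb : b ∈ A
        · rw [hd b hb]
        · rw [hA (1 + m) (by lia) a b hb, zero_mul, zero_mul]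
      | succ j ih => rw [iterVec, ih]; rfl
    have h1 := (hL 1 le_rfl d).1
    rw [h0 d] at h1
    have h2 := (h1.comp (tendsto_add_atTop_nat (m + 1))).const_mul (μ ^ m)
    rw [mul_zero] at h2
    have h3 := (hL (1 + m) (by lia) y).1.comp (tendsto_add_atTop_nat 1)
    refine tendsto_nhds_unique h3 (h2.congr fun j => ?_)
    have e : iterVec M 1 d (j + (m + 1)) = iterVec M (1 + m) y (j + 1) := by
      rw [← hcongr, ← iterVec_add]; congr 1; lia
    simp only [Function.comp_apply, e]
    have : μ ^ (j + (m + 1)) = μ ^ m * μ ^ (j + 1) := by ring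
    rw [this]
    field_simp
  have hlim : Tendsto (fun m : ℕ => K * τ ^ (1 + m) * ‖y‖) atTop (𝓝 0) := by
    have := ((tendsto_pow_atTop_nhds_zero_of_lt_one hτ0.le hτ1).comp
      (tendsto_add_atTop_nat 1)).const_mul K |>.mul_const ‖y‖
    simpa [Function.comp_def, add_comm] using this
  have hle : |w y| ≤ 0 := by
    refine ge_of_tendsto' hlim fun m => ?_
    have := (hL (1 + m) (by lia) y).2
    rwa [hLy, zero_sub, abs_neg] at this
  exact abs_nonpos_iff.1 hle

/-- The control points contract to a multiple of `(1, …, 1)` and, after the removal of this part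
and division by `l₁ ^ m`, converge to a combination of the subdominant eigenvectors; the
coefficients are linearly independent functionals of the initial data. -/
theorem Splitting.exists_asymptotics (sp : Splitting S l₁ v) (hS : IsStandard S l₁)
    (hvS : ∀ j, S.mulVec (v j) = l₁ • v j) (hns : NonSingularLocal M)
    (hC : 0 ≤ C) (hτ0 : 0 < τ) (hτl : τ < l₁) (hM : GeomClose M S C τ) :
    ∃ L₀ L₁ L₂ : (Idx E n p → ℝ) →ₗ[ℝ] ℝ,
      (∀ d, Tendsto (iterVec M 1 d) atTop (𝓝 (L₀ d • fun _ => 1))) ∧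
      (∀ d, Tendsto (fun m => (l₁ ^ m)⁻¹ •
          (iterVec M 1 d m - sp.w₀ (iterVec M 1 d m) • fun _ => 1)) atTop
        (𝓝 (L₁ d • v 0 + L₂ d • v 1))) ∧
      ∀ s t : ℝ, (∀ d, s * L₁ d + t * L₂ d = 0) → s = 0 ∧ t = 0 := by
  have hτ1 := hτl.trans hS.lt_one
  obtain ⟨K, hK0, hK⟩ := sp.exists_pow_bound hS hvS
  obtain ⟨B, hB0, hB⟩ := exists_iterVec_bound hK0 hK hC hτ0 hτ1 hM
  obtain ⟨L₀, _, hL₀⟩ := exists_limit_functional (w := sp.w₀) one_pos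
    (fun d => by rw [sp.w₀_mulVec, one_mul]) hC hτ0 hτ1 hM hB
  obtain ⟨L₁, _, hL₁⟩ := exists_limit_functional hS.pos sp.w₁_mulVec hC hτ0 hτl hM hB
  obtain ⟨L₂, _, hL₂⟩ := exists_limit_functional hS.pos sp.w₂_mulVec hC hτ0 hτl hM hB
  have hsub : ∀ d, Tendsto (fun m => (l₁ ^ m)⁻¹ •
      (iterVec M 1 d m - sp.w₀ (iterVec M 1 d m) • fun _ => 1)) atTop
      (𝓝 (L₁ 1 d • v 0 + L₂ 1 d • v 1)) := by
    intro d
    have h1 := ((hL₁ 1 le_rfl d).1.smul_const (v 0)).add ((hL₂ 1 le_rfl d).1.smul_const (v 1))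
    have h2 := h1.add (sp.tendsto_e hS.pos hC hτ0 hτ1 hτl hM hB0 hB d)
    rw [add_zero] at h2
    refine h2.congr fun m => ?_
    set x := iterVec M 1 d m
    have e : x - sp.w₀ x • (fun _ => (1 : ℝ)) = sp.w₁ x • v 0 + sp.w₂ x • v 1 + sp.e x := by
      rw [sub_eq_iff_eq_add]
      refine (sp.eq_add x).trans ?_
      abel
    rw [e, smul_add, smul_add, smul_smul, smul_smul, div_eq_inv_mul, div_eq_inv_mul]
  refine ⟨L₀ 1, L₁ 1, L₂ 1, fun d => ?_, hsub, fun s t hst => ?_⟩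
  · have h1 := (hL₀ 1 le_rfl d).1
    simp only [one_pow, div_one] at h1
    have h2 := h1.smul_const (fun _ => (1 : ℝ) : Idx E n p → ℝ)
    have h3 := (tendsto_pow_atTop_nhds_zero_of_lt_one hS.pos.le hS.lt_one).smul (hsub d)
    rw [zero_smul] at h3
    have h4 := h2.add h3
    rw [add_zero] at h4
    refine h4.congr fun m => ?_
    rw [smul_smul, mul_inv_cancel₀ (pow_pos hS.pos m).ne', one_smul, add_sub_cancel]
  · have hw : ∀ d, (s • sp.w₁ + t • sp.w₂) (S.mulVec d) = l₁ * (s • sp.w₁ + t • sp.w₂) d := by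
      intro d
      simp only [LinearMap.add_apply, LinearMap.smul_apply, sp.w₁_mulVec, sp.w₂_mulVec,
        smul_eq_mul]
      ring
    obtain ⟨L, K', hL⟩ := exists_limit_functional hS.pos hw hC hτ0 hτl hM hB
    have hL0 : ∀ d, L 1 d = 0 := by
      intro d
      rw [← hst d]
      refine tendsto_nhds_unique (hL 1 le_rfl d).1 ((((hL₁ 1 le_rfl d).1.const_mul s).add
        ((hL₂ 1 le_rfl d).1.const_mul t)).congr fun m => ?_)
      simp only [LinearMap.add_apply, LinearMap.smul_apply, smul_eq_mul]
      ring
    have hz := eq_zero_of_limit_functional_eq_zero hns hS.pos hτ0 hτ1 hL hL0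
    constructor
    · simpa [sp.w₁_v₀, sp.w₂_v₀] using hz (v 0)
    · simpa [sp.w₁_v₁, sp.w₂_v₁] using hz (v 1)

end ControlPoints

/-! ### Rings as finite combinations of translates -/

section Patches

variable {E : ExtraElem} {n p : ℕ} [NeZero n]

theorem sum_basisVec_smul {V : Type*} [AddCommGroup V] [Module ℝ V] (net : ControlNet E n p)
    {φ : ℝ × ℝ → ℝ} {R : ℕ} (hφ : ∀ x, R < ‖x‖ → φ x = 0) {k : ℕ} (l : ZMod n) (i : Fin 3)
    {x : ℝ × ℝ} {Y : ℝ} (hx : ‖(net.faces * dil k) • x‖ ≤ Y) (D : Idx E n p → V) :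
    ∑ a, basisVec net φ k l i x a • D a
      = ∑ β ∈ lattBall (R + Y), φ ((net.faces * dil k) • x - latt β) •
          D (rotate l (net.label i β)) := by
  classical
  have h : ∀ a, basisVec net φ k l i x a = ∑ β ∈ lattBall (R + Y),
      if rotate l (net.label i β) = a then φ ((net.faces * dil k) • x - latt β) else 0 := by
    intro a
    unfold basisVec
    rw [finsum_eq_sum_of_support_subset (s := lattBall (R + Y))]
    · refine Finset.sum_congr rfl fun β _ => ?_
      congr
    · intro β hβ
      rw [Finset.mem_coe, mem_lattBall]
      by_contra hlt
      push Not at hlt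
      refine hβ ?_
      have h1 : (R : ℝ) < ‖(net.faces * dil k) • x - latt β‖ := by
        have h2 := norm_sub_norm_le (latt β) ((net.faces * dil k) • x)
        rw [norm_latt, norm_sub_rev] at h2
        linarith
      have h3 := hφ _ h1
      simp only [latt] at h3
      simp [h3]
  simp only [h, Finset.sum_smul]
  rw [Finset.sum_comm]
  refine Finset.sum_congr rfl fun β _ => ?_
  simp [ite_smul]

/-- The directional derivative of a combination of translates of `φ`. -/
def dirSum {V : Type*} [AddCommGroup V] [Module ℝ V] (φ : ℝ × ℝ → ℝ) (Q : Finset (ℤ × ℤ))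
    (D : ℤ × ℤ → V) (h y : ℝ × ℝ) : V :=
  ∑ β ∈ Q, fderiv ℝ φ (y - latt β) h • D β

theorem hasFDerivAt_sum_translates {V : Type*} [NormedAddCommGroup V] [NormedSpace ℝ V]
    {φ : ℝ × ℝ → ℝ} (hφ : ContDiff ℝ 1 φ) (Q : Finset (ℤ × ℤ)) (D : ℤ × ℤ → V) (s : ℝ)
    (x : ℝ × ℝ) :
    ∃ F' : ℝ × ℝ →L[ℝ] V,
      HasFDerivAt (fun x => ∑ β ∈ Q, φ (s • x - latt β) • D β) F' x ∧
      ∀ h, F' h = s • dirSum φ Q D h (s • x) := by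
  refine ⟨∑ β ∈ Q, (s • fderiv ℝ φ (s • x - latt β)).smulRight (D β),
    HasFDerivAt.fun_sum fun β _ => ?_, fun h => ?_⟩
  · have h1 := ((hφ.differentiable one_ne_zero) (s • x - latt β)).hasFDerivAt.comp x
      (((hasFDerivAt_id x).const_smul s).sub_const (latt β))
    rw [ContinuousLinearMap.comp_smul, ContinuousLinearMap.comp_id] at h1
    exact h1.smul_const (D β)
  · simp [dirSum, Finset.smul_sum, smul_smul]

theorem partialU_eq {V : Type*} [NormedAddCommGroup V] [NormedSpace ℝ V] {F : ℝ × ℝ → V}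
    {F' : ℝ × ℝ →L[ℝ] V} {x : ℝ × ℝ} (h : HasFDerivAt F F' x) : partialU F x = F' (1, 0) := by
  have h1 : HasDerivAt (fun s : ℝ => (s, x.2)) ((1 : ℝ), (0 : ℝ)) x.1 :=
    (hasDerivAt_id x.1).prodMk (hasDerivAt_const x.1 x.2)
  have h2 : HasFDerivAt F F' ((fun s : ℝ => (s, x.2)) x.1) := h
  exact (h2.comp_hasDerivAt x.1 h1).deriv

theorem partialV_eq {V : Type*} [NormedAddCommGroup V] [NormedSpace ℝ V] {F : ℝ × ℝ → V}
    {F' : ℝ × ℝ →L[ℝ] V} {x : ℝ × ℝ} (h : HasFDerivAt F F' x) : partialV F x = F' (0, 1) := by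
  have h1 : HasDerivAt (fun s : ℝ => (x.1, s)) ((0 : ℝ), (1 : ℝ)) x.2 :=
    (hasDerivAt_const x.2 x.1).prodMk (hasDerivAt_id x.2)
  have h2 : HasFDerivAt F F' ((fun s : ℝ => (x.1, s)) x.2) := h
  exact (h2.comp_hasDerivAt x.2 h1).deriv

theorem partials_sum_basisVec {V : Type*} [NormedAddCommGroup V] [NormedSpace ℝ V]
    (net : ControlNet E n p) {φ : ℝ × ℝ → ℝ} (hφ1 : ContDiff ℝ 1 φ) {R : ℕ}
    (hφ : ∀ x, R < ‖x‖ → φ x = 0) {k : ℕ} (l : ZMod n) (i : Fin 3) {x : ℝ × ℝ} {Y : ℝ}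
    (hx : ‖(net.faces * dil k) • x‖ < Y) (D : Idx E n p → V) :
    let D' := fun β => D (rotate l (net.label i β))
    let s : ℝ := net.faces * dil k
    partialU (fun x => ∑ a, basisVec net φ k l i x a • D a) x
        = s • dirSum φ (lattBall (R + Y)) D' (1, 0) (s • x) ∧
    partialV (fun x => ∑ a, basisVec net φ k l i x a • D a) x
        = s • dirSum φ (lattBall (R + Y)) D' (0, 1) (s • x) := by
  intro D' s
  obtain ⟨F', hF', hF'e⟩ := hasFDerivAt_sum_translates hφ1 (lattBall (R + Y)) D' s x
  have hopen : IsOpen {x : ℝ × ℝ | ‖s • x‖ < Y} :=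
    isOpen_lt (continuous_const_smul s).norm continuous_const
  have h : HasFDerivAt (fun x => ∑ a, basisVec net φ k l i x a • D a) F' x := by
    refine hF'.congr_of_eventuallyEq ?_
    filter_upwards [hopen.mem_nhds hx] with x' hx'
    exact sum_basisVec_smul net hφ l i (le_of_lt hx') D
  rw [partialU_eq h, partialV_eq h, hF'e, hF'e]
  exact ⟨rfl, rfl⟩

end Patches

/-! ### The cells -/

theorem baseCell_convex (T : MeshType) (i : Fin 3) : Convex ℝ (baseCell T i) := by
  intro x hx y hy a b ha hb hab
  have hb' : b = 1 - a := by linarith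
  subst hb'
  cases T <;> fin_cases i <;>
    simp only [baseCell, Set.mem_ofPred_eq, Prod.fst_add, Prod.snd_add, Prod.smul_fst,
      Prod.smul_snd, smul_eq_mul] at hx hy ⊢ <;>
    refine ⟨?_, ?_, ?_⟩ <;> try refine ⟨?_, ?_⟩
  all_goals nlinarith

theorem exists_ball_subset_baseCell (T : MeshType) (i : Fin 3) :
    ∃ x, Metric.ball x (1 / 8) ⊆ baseCell T i := by
  have key : ∀ (S : Set (ℝ × ℝ)) (a b : ℝ),
      (∀ x : ℝ × ℝ, a - 1 / 8 < x.1 → x.1 < a + 1 / 8 → b - 1 / 8 < x.2 → x.2 < b + 1 / 8 → x ∈ S) →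
      ∃ x, Metric.ball x (1 / 8) ⊆ S := by
    intro S a b h
    refine ⟨(a, b), fun x hx => ?_⟩
    rw [Metric.mem_ball, Prod.dist_eq, max_lt_iff, Real.dist_eq, Real.dist_eq, abs_lt, abs_lt] at hx
    obtain ⟨⟨h1, h2⟩, h3, h4⟩ := hx
    simp only at h1 h2 h3 h4
    exact h x (by linarith) (by linarith) (by linarith) (by linarith)
  cases T <;> fin_cases i
  · refine key _ (3 / 2) (1 / 2) fun x _ _ _ _ => ?_
    simp only [baseCell, Set.mem_ofPred_eq]
    refine ⟨?_, ?_, ?_, ?_⟩ <;> linarith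
  · refine key _ (3 / 2) (3 / 2) fun x _ _ _ _ => ?_
    simp only [baseCell, Set.mem_ofPred_eq]
    refine ⟨?_, ?_, ?_, ?_⟩ <;> linarith
  · refine key _ (1 / 2) (3 / 2) fun x _ _ _ _ => ?_
    simp only [baseCell, Set.mem_ofPred_eq]
    refine ⟨?_, ?_, ?_, ?_⟩ <;> linarith
  · refine key _ (5 / 4) (1 / 4) fun x _ _ _ _ => ?_
    simp only [baseCell, Set.mem_ofPred_eq]
    refine ⟨?_, ?_, ?_⟩ <;> linarith
  · refine key _ (3 / 4) (3 / 4) fun x _ _ _ _ => ?_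
    simp only [baseCell, Set.mem_ofPred_eq]
    refine ⟨?_, ?_, ?_⟩ <;> linarith
  · refine key _ (1 / 4) (5 / 4) fun x _ _ _ _ => ?_
    simp only [baseCell, Set.mem_ofPred_eq]
    refine ⟨?_, ?_, ?_⟩ <;> linarith

theorem norm_le_of_mem_baseCell {T : MeshType} {i : Fin 3} {x : ℝ × ℝ} (hx : x ∈ baseCell T i) :
    ‖x‖ ≤ 2 := by
  rw [Prod.norm_def, max_le_iff, Real.norm_eq_abs, Real.norm_eq_abs, abs_le, abs_le]
  cases T <;> fin_cases i <;> simp only [baseCell, Set.mem_ofPred_eq] at hx <;>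
    refine ⟨⟨?_, ?_⟩, ?_, ?_⟩ <;> linarith [hx.1, hx.2.1, hx.2.2]

theorem isClosed_baseCell (T : MeshType) (i : Fin 3) : IsClosed (baseCell T i) := by
  cases T <;> fin_cases i <;> simp only [baseCell, Set.ofPred_and] <;>
    repeat' apply IsClosed.inter
  all_goals exact isClosed_le (by fun_prop) (by fun_prop)

theorem isCompact_baseCell (T : MeshType) (i : Fin 3) : IsCompact (baseCell T i) :=
  (isCompact_closedBall (0 : ℝ × ℝ) 2).of_isClosed_subset (isClosed_baseCell T i)
    fun _ hx => mem_closedBall_zero_iff.2 (norm_le_of_mem_baseCell hx)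

theorem dil_pos (k : ℕ) : 0 < dil k := by unfold dil; positivity

theorem mem_cell_iff {T : MeshType} {k : ℕ} {i : Fin 3} {x : ℝ × ℝ} :
    x ∈ cell T k i ↔ dil k • x ∈ baseCell T i := Iff.rfl

theorem dil_one : dil 1 = 1 := by simp [dil]

theorem cell_nonempty (T : MeshType) (k : ℕ) (i : Fin 3) : (cell T k i).Nonempty := by
  obtain ⟨x, hx⟩ := exists_ball_subset_baseCell T i
  refine ⟨(dil k)⁻¹ • x, ?_⟩
  rw [mem_cell_iff, smul_inv_smul₀ (dil_pos k).ne']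
  exact hx (Metric.mem_ball_self (by norm_num))

/-- A `C¹` function that is constant on a cell has vanishing derivative on the closed cell. -/
theorem fderiv_eq_zero_of_const_on_baseCell {T : MeshType} {i : Fin 3} {f : ℝ × ℝ → ℝ}
    (hf : ContDiff ℝ 1 f) {a : ℝ} (h : ∀ x ∈ baseCell T i, f x = a) {x : ℝ × ℝ}
    (hx : x ∈ baseCell T i) : fderiv ℝ f x = 0 := by
  have hint : (interior (baseCell T i)).Nonempty := by
    obtain ⟨x, hx⟩ := exists_ball_subset_baseCell T i
    exact ⟨x, interior_maximal hx Metric.isOpen_ball (Metric.mem_ball_self (by norm_num))⟩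
  have hcl : x ∈ closure (interior (baseCell T i)) := by
    rw [(baseCell_convex T i).closure_interior_eq_closure_of_nonempty_interior hint]
    exact subset_closure hx
  have hclosed : IsClosed {x | fderiv ℝ f x = 0} :=
    isClosed_eq (hf.continuous_fderiv one_ne_zero) continuous_const
  refine closure_minimal (fun y hy => ?_) hclosed hcl
  have he : f =ᶠ[𝓝 y] fun _ => a := by
    filter_upwards [isOpen_interior.mem_nhds hy] with z hz
    exact h z (interior_subset hz)
  rw [Set.mem_ofPred_eq, he.fderiv_eq, fderiv_const_apply]

theorem norm_smul_le_of_mem_cell {E : ExtraElem} {n p : ℕ} (net : ControlNet E n p)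
    {k : ℕ} {i : Fin 3} {x : ℝ × ℝ} (hx : x ∈ cell net.meshType k i) :
    ‖(net.faces * dil k) • x‖ ≤ net.faces * 2 := by
  rw [mul_smul, norm_smul, Real.norm_of_nonneg (Nat.cast_nonneg _)]
  exact mul_le_mul_of_nonneg_left (norm_le_of_mem_baseCell hx) (Nat.cast_nonneg _)

section Limit

variable {E : ExtraElem} {n p : ℕ} [NeZero n]

/-! ### Generic initial data -/

/-- The values of the functional `L` at the three coordinates of the data. -/
def coordMap (L : (Idx E n p → ℝ) →ₗ[ℝ] ℝ) (D : Idx E n p → Fin 3 → ℝ) : Fin 3 → ℝ :=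
  fun j => L fun a => D a j

theorem prod_surjective {V : Type*} [AddCommGroup V] [Module ℝ V] {L₁ L₂ : V →ₗ[ℝ] ℝ}
    (h : ∀ s t : ℝ, (∀ d, s * L₁ d + t * L₂ d = 0) → s = 0 ∧ t = 0) (x y : ℝ) :
    ∃ d, L₁ d = x ∧ L₂ d = y := by
  have hr : LinearMap.range (L₁.prod L₂) = ⊤ := by
    by_contra hne
    obtain ⟨f, hf0, hf⟩ := Submodule.exists_le_ker_of_lt_top _ (lt_top_iff_ne_top.2 hne)
    have hfe : ∀ a b : ℝ, f (a, b) = f (1, 0) * a + f (0, 1) * b := by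
      intro a b
      have : ((a, b) : ℝ × ℝ) = a • (1, 0) + b • (0, 1) := by simp
      rw [this, map_add, map_smul, map_smul, smul_eq_mul, smul_eq_mul, mul_comm a, mul_comm b]
    obtain ⟨h1, h2⟩ := h (f (1, 0)) (f (0, 1)) fun d => by
      rw [← hfe]
      exact hf (LinearMap.mem_range_self (L₁.prod L₂) d)
    refine hf0 (LinearMap.ext fun q => ?_)
    rw [← Prod.mk.eta (p := q), hfe, h1, h2]
    simp
  obtain ⟨d, hd⟩ := LinearMap.range_eq_top.1 hr (x, y)
  exact ⟨d, congrArg Prod.fst hd, congrArg Prod.snd hd⟩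

theorem ae_det_ne_zero : ∀ᵐ q : (ℝ × ℝ) × (ℝ × ℝ), q.1.1 * q.2.2 - q.1.2 * q.2.1 ≠ 0 := by
  have hm : MeasurableSet {q : (ℝ × ℝ) × (ℝ × ℝ) | q.1.1 * q.2.2 - q.1.2 * q.2.1 ≠ 0} :=
    (isOpen_ne_fun (by fun_prop) continuous_const).measurableSet
  rw [Measure.volume_eq_prod, Measure.ae_prod_iff_ae_ae hm]
  have h0 : ∀ᵐ a : ℝ × ℝ, a ≠ 0 := by
    rw [ae_iff]; simp
  filter_upwards [h0] with a ha
  let f : ℝ × ℝ →ₗ[ℝ] ℝ := a.1 • LinearMap.snd ℝ ℝ ℝ - a.2 • LinearMap.fst ℝ ℝ ℝ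
  have hf : LinearMap.ker f ≠ ⊤ := by
    intro htop
    have h1 : ∀ b, f b = 0 := fun b => by
      have : b ∈ LinearMap.ker f := htop ▸ Submodule.mem_top
      exact this
    refine ha (Prod.ext ?_ ?_)
    · simpa [f] using h1 (0, 1)
    · simpa [f] using h1 (1, 0)
  have hz := Measure.addHaar_submodule (volume : Measure (ℝ × ℝ)) _ hf
  rw [ae_iff]
  convert hz using 2
  ext b
  simp [f]

theorem ae_cross_ne_zero {L₁ L₂ : (Idx E n p → ℝ) →ₗ[ℝ] ℝ}
    (h : ∀ s t : ℝ, (∀ d, s * L₁ d + t * L₂ d = 0) → s = 0 ∧ t = 0) :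
    ∀ᵐ D : Idx E n p → Fin 3 → ℝ, crossProduct (coordMap L₁ D) (coordMap L₂ D) ≠ 0 := by
  let c : Fin 3 → (Idx E n p → Fin 3 → ℝ) →ₗ[ℝ] (Idx E n p → ℝ) := fun j =>
    { toFun := fun D a => D a j
      map_add' := fun _ _ => rfl
      map_smul' := fun _ _ => rfl }
  let Λ : (Idx E n p → Fin 3 → ℝ) →ₗ[ℝ] (ℝ × ℝ) × (ℝ × ℝ) :=
    ((L₁ ∘ₗ c 0).prod (L₁ ∘ₗ c 1)).prod ((L₂ ∘ₗ c 0).prod (L₂ ∘ₗ c 1))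
  have hsurj : Function.Surjective Λ := by
    rintro ⟨⟨x₀, x₁⟩, y₀, y₁⟩
    obtain ⟨d₀, h1, h2⟩ := prod_surjective h x₀ y₀
    obtain ⟨d₁, h3, h4⟩ := prod_surjective h x₁ y₁
    refine ⟨fun a => ![d₀ a, d₁ a, 0], ?_⟩
    change ((L₁ d₀, L₁ d₁), (L₂ d₀, L₂ d₁)) = _
    rw [h1, h2, h3, h4]
  have hm : MeasurableSet {q : (ℝ × ℝ) × (ℝ × ℝ) | q.1.1 * q.2.2 - q.1.2 * q.2.1 ≠ 0} :=
    (isOpen_ne_fun (by fun_prop) continuous_const).measurableSet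
  have hhaar : (volume : Measure (Idx E n p → Fin 3 → ℝ)).IsAddHaarMeasure :=
    Measure.pi.isAddHaarMeasure _
  have hhaar' : (volume : Measure ((ℝ × ℝ) × (ℝ × ℝ))).IsAddHaarMeasure :=
    Measure.prod.instIsAddHaarMeasure _ _
  have hae := (ae_comp_linearMap_mem_iff Λ (volume : Measure (Idx E n p → Fin 3 → ℝ))
    (volume : Measure ((ℝ × ℝ) × (ℝ × ℝ))) hsurj hm).2 ae_det_ne_zero
  filter_upwards [hae] with D hD hcross
  refine hD ?_
  have h2 := congrFun hcross 2
  simpa [cross_apply, coordMap, Λ, c] using h2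

theorem norm_cross_le (u w : Fin 3 → ℝ) : ‖crossProduct u w‖ ≤ 2 * ‖u‖ * ‖w‖ := by
  have key : ∀ i j k l : Fin 3, |u i * w j - u k * w l| ≤ 2 * ‖u‖ * ‖w‖ := by
    intro i j k l
    have h : ∀ i j, |u i * w j| ≤ ‖u‖ * ‖w‖ := fun i j => by
      rw [abs_mul]
      exact mul_le_mul (norm_le_pi_norm u i) (norm_le_pi_norm w j) (abs_nonneg _) (norm_nonneg _)
    linarith [abs_sub (u i * w j) (u k * w l), h i j, h k l]
  refine (pi_norm_le_iff_of_nonneg (by positivity)).2 fun j => ?_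
  rw [cross_apply]
  fin_cases j <;> exact key _ _ _ _

theorem cross_add_smul (A B : Fin 3 → ℝ) (a b c d : ℝ) :
    crossProduct (a • A + b • B) (c • A + d • B) = (a * d - b * c) • crossProduct A B := by
  simp only [map_add, map_smul, LinearMap.add_apply, LinearMap.smul_apply, cross_self]
  rw [← cross_anticomm A B]
  module

/-! ### The limits of the control points -/

theorem tendsto_of_succ {X : Type*} [TopologicalSpace X] {f : ℕ → X} {x : X}
    (h : Tendsto (fun m => f (m + 1)) atTop (𝓝 x)) : Tendsto f atTop (𝓝 x) :=
  (tendsto_add_atTop_iff_nat 1).1 h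

/-- The control points of level `k` are `q_k + t_k z_k` with `t_k > 0` and a convergent `z_k`. -/
theorem exists_controlPoints_asymptotics {M : ℕ → Matrix (Idx E n p) (Idx E n p) ℝ}
    {S : Matrix (Idx E n p) (Idx E n p) ℝ} {l₁ : ℝ} {v : Fin 2 → Idx E n p → ℝ}
    (hS : IsStandard S l₁) (hv : LinearIndependent ℝ v)
    (hvS : ∀ j, S.mulVec (v j) = l₁ • v j) (hns : NonSingularLocal M)
    (hM : ∃ C σ : ℝ, 1 / l₁ < σ ∧ ∀ k, 1 ≤ k → rowSumNorm (M k - S) ≤ C / σ ^ k) :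
    ∃ L₀ L₁ L₂ : (Idx E n p → ℝ) →ₗ[ℝ] ℝ,
      (∀ D a, Tendsto (fun k => controlPoints M D k a) atTop (𝓝 (coordMap L₀ D))) ∧
      (∀ D, ∃ (q : ℕ → Fin 3 → ℝ) (t : ℕ → ℝ) (z : ℕ → Idx E n p → Fin 3 → ℝ),
        (∀ k, 1 ≤ k → 0 < t k ∧ ∀ a, controlPoints M D k a = q k + t k • z k a) ∧
        ∀ a, Tendsto (fun k => z k a) atTop
          (𝓝 (v 0 a • coordMap L₁ D + v 1 a • coordMap L₂ D))) ∧
      ∀ s t : ℝ, (∀ d, s * L₁ d + t * L₂ d = 0) → s = 0 ∧ t = 0 := by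
  obtain ⟨C, σ, hσ, hCσ⟩ := hM
  have hl := hS.pos
  have hσ0 : 0 < σ := (one_div_pos.2 hl).trans hσ
  have hC : 0 ≤ C := by
    have h := (rowSumNorm_nonneg _).trans (hCσ 1 le_rfl)
    rwa [pow_one, le_div_iff₀ hσ0, zero_mul] at h
  have hclose : GeomClose M S C σ⁻¹ := fun k hk d => by
    refine (norm_mulVec_le_rowSumNorm _ d).trans ?_
    rw [inv_pow, ← div_eq_mul_inv]
    exact mul_le_mul_of_nonneg_right (hCσ k hk) (norm_nonneg d)
  have hτl : σ⁻¹ < l₁ := by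
    rw [one_div] at hσ
    exact inv_lt_of_inv_lt₀ hl hσ
  obtain ⟨sp⟩ := hS.nonempty_splitting hv hvS
  obtain ⟨L₀, L₁, L₂, h0, h1, hind⟩ :=
    sp.exists_asymptotics hS hvS hns hC (inv_pos.2 hσ0) hτl hclose
  refine ⟨L₀, L₁, L₂, fun D a => tendsto_of_succ (tendsto_pi_nhds.2 fun j => ?_), fun D => ?_,
    hind⟩
  · have h := (tendsto_pi_nhds.1 (h0 fun a => D a j)) a
    simp only [Pi.smul_apply, smul_eq_mul, mul_one] at h
    simpa only [controlPoints_succ, coordMap] using h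
  · refine ⟨fun k j => sp.w₀ fun a => controlPoints M D k a j, fun k => l₁ ^ (k - 1),
      fun k a j => (l₁ ^ (k - 1))⁻¹ *
        (controlPoints M D k a j - sp.w₀ fun a => controlPoints M D k a j), fun k _ => ?_,
      fun a => tendsto_of_succ (tendsto_pi_nhds.2 fun j => ?_)⟩
    · have ht : 0 < l₁ ^ (k - 1) := pow_pos hl _
      refine ⟨ht, fun a => ?_⟩
      funext j
      simp only [Pi.add_apply, Pi.smul_apply, smul_eq_mul]
      rw [mul_inv_cancel_left₀ ht.ne', add_sub_cancel]
    · have h := (tendsto_pi_nhds.1 (h1 fun a => D a j)) a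
      simp only [Pi.smul_apply, Pi.sub_apply, Pi.add_apply, smul_eq_mul, mul_one] at h
      simp only [controlPoints_succ, coordMap, Pi.add_apply, Pi.smul_apply, smul_eq_mul,
        add_tsub_cancel_right]
      rw [mul_comm (v 0 a), mul_comm (v 1 a)]
      exact h

/-! ### Uniform convergence of the rings and of their partial derivatives -/

/-- The functions `φk k`, `k ≥ 1`, with supports in the ball of radius `R`, converge in `C¹`
to `φ`, with errors at most `η k`. -/
structure C1Approx (φk : ℕ → ℝ × ℝ → ℝ) (φ : ℝ × ℝ → ℝ) (R : ℕ) (η : ℕ → ℝ) (K : ℝ) : Prop where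
  contDiff : ∀ k, 1 ≤ k → ContDiff ℝ 1 (φk k)
  contDiff_lim : ContDiff ℝ 1 φ
  eq_zero : ∀ k, 1 ≤ k → ∀ x, R < ‖x‖ → φk k x = 0
  eq_zero_lim : ∀ x, R < ‖x‖ → φ x = 0
  tendsto : Tendsto η atTop (𝓝 0)
  dist_le : ∀ k, 1 ≤ k → ∀ x, |φk k x - φ x| ≤ η k
  fderiv_dist_le : ∀ k, 1 ≤ k → ∀ x, ‖fderiv ℝ (φk k) x - fderiv ℝ φ x‖ ≤ η k
  bound : ∀ x, |φ x| ≤ K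
  fderiv_bound : ∀ x, ‖fderiv ℝ φ x‖ ≤ K

theorem exists_C1Approx {ck : ℕ → Mask} {c : Mask} {F : Finset (ℤ × ℤ)}
    (hF : ∀ k, 1 ≤ k → (ck k).support ⊆ F) (hc : C1Convergent fun _ => c)
    (hw : Summable (weight ck c)) :
    ∃ R η K, C1Approx (basicLimit ck) (basicLimit (fun _ => c) 1) R η K := by
  obtain ⟨R, hR⟩ := exists_suppRadius (F ∪ c.support)
  have hRc : SuppRadius (fun _ => c) 1 R := fun _ _ α hα =>
    hR α (Finset.mem_union_right _ (Finsupp.mem_support_iff.2 hα))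
  have hRk : SuppRadius ck 1 R := fun j hj α hα =>
    hR α (Finset.mem_union_left _ (hF j hj (Finsupp.mem_support_iff.2 hα)))
  obtain ⟨φ, hφ⟩ := hc.1.1 delta boundedData_delta
  have hφ1 := hc.2 _ _ boundedData_delta hφ
  obtain ⟨K₁, -, hK₁⟩ := exists_limit_bound hRc hφ hφ1
  obtain ⟨K, hK⟩ := exists_limit_of_asympEquiv hc hw
  refine ⟨R, fun k => K * 1 * ∑' m, weight ck c (k + m), K₁ * 1, ?_⟩
  have hex : ∀ k, 1 ≤ k → ∃ g, basicLimit ck k = g ∧ IsLimit ck k delta g ∧ ContDiff ℝ 1 g ∧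
      ∀ x, |g x - φ x| ≤ K * 1 * ∑' m, weight ck c (k + m) ∧
        ‖fderiv ℝ g x - fderiv ℝ φ x‖ ≤ K * 1 * ∑' m, weight ck c (k + m) := by
    intro k hk
    obtain ⟨g, hg, hg1, hgd⟩ := hK k hk delta 1 abs_delta_le
    exact ⟨g, basicLimit_eq hg, hg, hg1, hgd φ hφ⟩
  rw [basicLimit_eq hφ]
  refine ⟨fun k hk => ?_, hφ1, fun k hk x hx => ?_, fun x hx => hφ.eq_zero_of_lt hRc hx, ?_,
    fun k hk x => ?_, fun k hk x => ?_, fun x => (hK₁ _ _ _ abs_delta_le hφ x).1,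
    fun x => (hK₁ _ _ _ abs_delta_le hφ x).2⟩
  · obtain ⟨g, h1, -, h2, -⟩ := hex k hk
    rwa [h1]
  · obtain ⟨g, h1, h2, -⟩ := hex k hk
    rw [h1]
    exact h2.eq_zero_of_lt (hRk.mono hk) hx
  · simpa using (tsum_weight_tendsto ck c).const_mul (K * 1)
  · obtain ⟨g, h1, -, -, h2⟩ := hex k hk
    rw [h1]
    exact (h2 x).1
  · obtain ⟨g, h1, -, -, h2⟩ := hex k hk
    rw [h1]
    exact (h2 x).2

theorem exists_sum_smul_bound {Y V : Type*} [NormedAddCommGroup V] [NormedSpace ℝ V]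
    {u : ℕ → Y → ℤ × ℤ → ℝ} {u' : Y → ℤ × ℤ → ℝ} {η : ℕ → ℝ} {K : ℝ}
    (hη : Tendsto η atTop (𝓝 0)) (hu : ∀ k, 1 ≤ k → ∀ y β, |u k y β - u' y β| ≤ η k)
    (hK : ∀ y β, |u' y β| ≤ K) (Q : Finset (ℤ × ℤ)) {D : ℕ → ℤ × ℤ → V} {D' : ℤ × ℤ → V}
    (hD : ∀ β, Tendsto (fun k => D k β) atTop (𝓝 (D' β))) :
    ∃ b : ℕ → ℝ, Tendsto b atTop (𝓝 0) ∧ ∀ k, 1 ≤ k → ∀ y,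
      ‖∑ β ∈ Q, u k y β • D k β - ∑ β ∈ Q, u' y β • D' β‖ ≤ b k := by
  refine ⟨fun k => ∑ β ∈ Q, (η k * ‖D k β‖ + K * ‖D k β - D' β‖), ?_, fun k hk y => ?_⟩
  · have h : Tendsto (fun k => ∑ β ∈ Q, (η k * ‖D k β‖ + K * ‖D k β - D' β‖)) atTop
        (𝓝 (∑ β ∈ Q, (0 * ‖D' β‖ + K * ‖D' β - D' β‖))) :=
      tendsto_finsetSum _ fun β _ => (hη.mul (hD β).norm).add
        (((hD β).sub_const (D' β)).norm.const_mul K)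
    simpa using h
  · rw [← Finset.sum_sub_distrib]
    refine (norm_sum_le _ _).trans (Finset.sum_le_sum fun β _ => ?_)
    have e : u k y β • D k β - u' y β • D' β
        = (u k y β - u' y β) • D k β + u' y β • (D k β - D' β) := by
      rw [sub_smul, smul_sub]; abel
    rw [e]
    refine (norm_add_le _ _).trans (add_le_add ?_ ?_)
    · rw [norm_smul]
      exact mul_le_mul_of_nonneg_right (hu k hk y β) (norm_nonneg _)
    · rw [norm_smul]
      exact mul_le_mul_of_nonneg_right (hK y β) (norm_nonneg _)

variable {φk : ℕ → ℝ × ℝ → ℝ} {φ : ℝ × ℝ → ℝ} {R : ℕ} {η : ℕ → ℝ} {K : ℝ}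

theorem C1Approx.exists_dirSum_bound {V : Type*} [NormedAddCommGroup V] [NormedSpace ℝ V]
    (hφ : C1Approx φk φ R η K) (Q : Finset (ℤ × ℤ)) {D : ℕ → ℤ × ℤ → V} {D' : ℤ × ℤ → V}
    (hD : ∀ β, Tendsto (fun k => D k β) atTop (𝓝 (D' β))) {h : ℝ × ℝ} (hh : ‖h‖ ≤ 1) :
    ∃ b : ℕ → ℝ, Tendsto b atTop (𝓝 0) ∧ ∀ k, 1 ≤ k → ∀ y,
      ‖dirSum (φk k) Q (D k) h y - dirSum φ Q D' h y‖ ≤ b k := by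
  refine exists_sum_smul_bound (Y := ℝ × ℝ) (u := fun k y β => fderiv ℝ (φk k) (y - latt β) h)
    (u' := fun y β => fderiv ℝ φ (y - latt β) h) hφ.tendsto (fun k hk y β => ?_)
    (K := K) (fun y β => ?_) Q hD
  · have := (fderiv ℝ (φk k) (y - latt β) - fderiv ℝ φ (y - latt β)).le_of_opNorm_le_of_le
      (hφ.fderiv_dist_le k hk _) hh
    simpa using this
  · simpa using (fderiv ℝ φ (y - latt β)).le_of_opNorm_le_of_le (hφ.fderiv_bound _) hh

theorem C1Approx.norm_dirSum_le {V : Type*} [NormedAddCommGroup V] [NormedSpace ℝ V]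
    (hφ : C1Approx φk φ R η K) (Q : Finset (ℤ × ℤ)) (D : ℤ × ℤ → V) {h : ℝ × ℝ} (hh : ‖h‖ ≤ 1)
    (y : ℝ × ℝ) : ‖dirSum φ Q D h y‖ ≤ ∑ β ∈ Q, K * ‖D β‖ := by
  refine (norm_sum_le _ _).trans (Finset.sum_le_sum fun β _ => ?_)
  rw [norm_smul]
  refine mul_le_mul_of_nonneg_right ?_ (norm_nonneg _)
  simpa using (fderiv ℝ φ (y - latt β)).le_of_opNorm_le_of_le (hφ.fderiv_bound _) hh

/-- The normalization of a vector in the Euclidean norm. -/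
def normalize (w : Fin 3 → ℝ) : Fin 3 → ℝ := ‖WithLp.toLp 2 w‖⁻¹ • w

theorem normalize_smul {t : ℝ} (ht : 0 < t) (w : Fin 3 → ℝ) : normalize (t • w) = normalize w := by
  unfold normalize
  rw [WithLp.toLp_smul, norm_smul, Real.norm_of_nonneg ht.le, smul_smul, mul_inv, mul_right_comm,
    inv_mul_cancel₀ ht.ne', one_mul]

theorem continuousAt_normalize {w : Fin 3 → ℝ} (hw : w ≠ 0) : ContinuousAt normalize w := by
  have h1 : ContinuousAt (fun w : Fin 3 → ℝ => ‖WithLp.toLp 2 w‖) w :=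
    (PiLp.continuous_toLp 2 (fun _ : Fin 3 => ℝ)).norm.continuousAt
  have h2 : ‖WithLp.toLp 2 w‖ ≠ 0 := by
    rw [norm_ne_zero_iff]
    simpa using hw
  exact (h1.inv₀ h2).smul continuousAt_id

variable (net : ControlNet E n p)

/-- The lattice points whose translates can reach the rescaled cells. -/
abbrev reach (R : ℕ) : Finset (ℤ × ℤ) := lattBall (R + (net.faces * 2 + 1))

theorem ring_eq_sum {V : Type*} [AddCommGroup V] [Module ℝ V] (hφ : ∀ x, R < ‖x‖ → φ x = 0)
    {k : ℕ} (l : ZMod n) {i : Fin 3} {x : ℝ × ℝ} (hx : x ∈ cell net.meshType k i)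
    (D : Idx E n p → V) :
    ∑ a, basisVec net φ k l i x a • D a = ∑ β ∈ reach net R,
      φ ((net.faces * dil k) • x - latt β) • D (rotate l (net.label i β)) :=
  sum_basisVec_smul net hφ l i ((norm_smul_le_of_mem_cell net hx).trans (by linarith)) D

/-- If the basis functions sum up to a constant on a cell, then their derivatives sum up
to zero. -/
theorem dirSum_const_eq_zero (hφ1 : ContDiff ℝ 1 φ) (hφ : ∀ x, R < ‖x‖ → φ x = 0) {k : ℕ}
    (l : ZMod n) {i : Fin 3} {α : ℝ}
    (hα : ∀ x ∈ cell net.meshType k i, ∑ a, basisVec net φ k l i x a = α) {x : ℝ × ℝ}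
    (hx : x ∈ cell net.meshType k i) (h : ℝ × ℝ) :
    dirSum φ (reach net R) (fun _ => (1 : ℝ)) h ((net.faces * dil k) • x) = 0 := by
  obtain ⟨F', hF', hF'e⟩ := hasFDerivAt_sum_translates hφ1 (reach net R) (fun _ => (1 : ℝ))
    net.faces (dil k • x)
  have hcd : ContDiff ℝ 1 fun x : ℝ × ℝ =>
      ∑ β ∈ reach net R, φ ((net.faces : ℝ) • x - latt β) • (1 : ℝ) :=
    ContDiff.sum fun β _ => (hφ1.comp ((contDiff_id.const_smul _).sub contDiff_const)).smul
      contDiff_const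
  have hconst : ∀ X ∈ baseCell net.meshType i,
      ∑ β ∈ reach net R, φ ((net.faces : ℝ) • X - latt β) • (1 : ℝ) = α := by
    intro X hX
    have e : dil k • ((dil k)⁻¹ • X) = X := smul_inv_smul₀ (dil_pos k).ne' X
    have hX' : (dil k)⁻¹ • X ∈ cell net.meshType k i := by rwa [mem_cell_iff, e]
    have h1 := ring_eq_sum net hφ l hX' (fun _ => (1 : ℝ))
    rw [mul_smul, e] at h1
    rw [← h1, ← hα _ hX']
    simp
  have h0 := fderiv_eq_zero_of_const_on_baseCell hcd hconst hx
  rw [hF'.fderiv] at h0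
  have h1 := hF'e h
  rw [h0, smul_smul, zero_apply] at h1
  have hf : (net.faces : ℝ) ≠ 0 := Nat.cast_ne_zero.2 net.faces_pos.ne'
  exact (smul_eq_zero.1 h1.symm).resolve_left hf

theorem dirSum_add_smul {V : Type*} [AddCommGroup V] [Module ℝ V] (Q : Finset (ℤ × ℤ)) (q : V)
    (t : ℝ) (z : ℤ × ℤ → V) (h y : ℝ × ℝ) :
    dirSum φ Q (fun β => q + t • z β) h y
      = dirSum φ Q (fun _ => (1 : ℝ)) h y • q + t • dirSum φ Q z h y := by
  simp only [dirSum, smul_add, Finset.sum_add_distrib, Finset.sum_smul, Finset.smul_sum, smul_smul,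
    smul_eq_mul, mul_one, mul_comm t]

theorem dirSum_smul_add {V : Type*} [AddCommGroup V] [Module ℝ V] (Q : Finset (ℤ × ℤ)) (A B : V)
    (a b : ℤ × ℤ → ℝ) (h y : ℝ × ℝ) :
    dirSum φ Q (fun β => a β • A + b β • B) h y
      = dirSum φ Q a h y • A + dirSum φ Q b h y • B := by
  simp only [dirSum, smul_add, Finset.sum_add_distrib, Finset.sum_smul, smul_smul, smul_eq_mul]

theorem continuous_dirSum (hφ : ContDiff ℝ 1 φ) (Q : Finset (ℤ × ℤ)) (a : ℤ × ℤ → ℝ) (h : ℝ × ℝ) :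
    Continuous fun y => dirSum φ Q a h y := by
  unfold dirSum
  refine continuous_finsetSum _ fun β _ => ?_
  have h1 : Continuous fun y => fderiv ℝ φ (y - latt β) h :=
    ((hφ.continuous_fderiv one_ne_zero).comp (continuous_id.sub continuous_const)).clm_apply
      continuous_const
  exact h1.smul continuous_const

end Limit

theorem RingTendsto.unique {n : ℕ} {T : MeshType} {F : ℕ → ZMod n → Fin 3 → ℝ × ℝ → Fin 3 → ℝ}
    {ν ν' : Fin 3 → ℝ} (h : RingTendsto T F ν) (h' : RingTendsto T F ν') : ν = ν' := by
  refine eq_of_forall_dist_le fun ε hε => ?_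
  obtain ⟨k, h1, h2⟩ := ((h (ε / 2) (by linarith)).and (h' (ε / 2) (by linarith))).exists
  obtain ⟨x, hx⟩ := cell_nonempty T k 0
  have h3 := h1 0 0 x hx
  have h4 := h2 0 0 x hx
  rw [← dist_eq_norm] at h3 h4
  linarith [dist_triangle_left ν ν' (F k 0 0 x)]

section Normals

variable {E : ExtraElem} {n p : ℕ} [NeZero n] (net : ControlNet E n p)

/-! ### Convergence of the rings to a point -/

theorem convergentIrregular_of_approx {𝒮 : Scheme E n p} {φ : ℝ × ℝ → ℝ} {R : ℕ} {η : ℕ → ℝ}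
    {K : ℝ} (hφ : C1Approx (basicLimit 𝒮.mask) φ R η K) {α : ℕ → ℝ}
    (hα : ∀ k, 1 ≤ k → ∀ l i, ∀ x ∈ cell net.meshType k i,
      ∑ a, basisVec net (basicLimit 𝒮.mask k) k l i x a = α k)
    (hd : ∀ D, ∃ q : Fin 3 → ℝ, ∀ a,
      Tendsto (fun k => controlPoints 𝒮.mat D k a) atTop (𝓝 q)) :
    ConvergentIrregular net 𝒮 := by
  -- the constants `α k` converge to the sum of the stationary basis functions
  have hαlim : ∃ α' : ℝ, Tendsto α atTop (𝓝 α') := by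
    obtain ⟨x₀, hx₀⟩ := exists_ball_subset_baseCell net.meshType 0
    have hx₀' := hx₀ (Metric.mem_ball_self (by norm_num))
    refine ⟨∑ β ∈ reach net R, φ ((net.faces : ℝ) • x₀ - latt β) • 1, ?_⟩
    have h : Tendsto (fun k => ∑ β ∈ reach net R,
        basicLimit 𝒮.mask k ((net.faces : ℝ) • x₀ - latt β) • (1 : ℝ)) atTop
        (𝓝 (∑ β ∈ reach net R, φ ((net.faces : ℝ) • x₀ - latt β) • 1)) := by
      refine tendsto_finsetSum _ fun β _ => Tendsto.smul_const ?_ _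
      rw [tendsto_iff_dist_tendsto_zero]
      refine squeeze_zero' (Eventually.of_forall fun _ => dist_nonneg) ?_ hφ.tendsto
      filter_upwards [eventually_ge_atTop 1] with k hk using hφ.dist_le k hk _
    refine h.congr' ?_
    filter_upwards [eventually_ge_atTop 1] with k hk
    have e : dil k • ((dil k)⁻¹ • x₀) = x₀ := smul_inv_smul₀ (dil_pos k).ne' x₀
    have hX : (dil k)⁻¹ • x₀ ∈ cell net.meshType k 0 := by rwa [mem_cell_iff, e]
    have h1 := ring_eq_sum net (hφ.eq_zero k hk) (0 : ZMod n) hX fun _ => (1 : ℝ)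
    rw [mul_smul, e] at h1
    rw [← h1, ← hα k hk 0 0 _ hX]
    simp
  obtain ⟨α', hα'⟩ := hαlim
  intro D
  obtain ⟨q, hq⟩ := hd D
  refine ⟨α' • q, fun ε hε => ?_⟩
  rw [eventually_all]
  intro l
  rw [eventually_all]
  intro i
  obtain ⟨b, hb0, hb⟩ := exists_sum_smul_bound (Y := ℝ × ℝ)
    (u := fun k y β => basicLimit 𝒮.mask k (y - latt β)) (u' := fun y β => φ (y - latt β))
    hφ.tendsto (fun k hk y β => hφ.dist_le k hk _) (fun y β => hφ.bound _) (reach net R)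
    (D := fun k β => controlPoints 𝒮.mat D k (rotate l (net.label i β)) - q)
    (D' := fun _ => 0) (fun β => by simpa using (hq (rotate l (net.label i β))).sub_const q)
  have hc : Tendsto (fun k => b k + ‖α k • q - α' • q‖) atTop (𝓝 0) := by
    simpa using hb0.add ((hα'.smul_const q).sub_const (α' • q)).norm
  filter_upwards [hc.eventually_le_const hε, eventually_ge_atTop 1] with k hk hk1 x hx
  have h1 : ringPatch net 𝒮 D k l i x = ∑ β ∈ reach net R,
      basicLimit 𝒮.mask k ((net.faces * dil k) • x - latt β) •
        (controlPoints 𝒮.mat D k (rotate l (net.label i β)) - q) + α k • q := by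
    rw [← ring_eq_sum net (hφ.eq_zero k hk1) l hx fun a => controlPoints 𝒮.mat D k a - q,
      ← hα k hk1 l i x hx, Finset.sum_smul, ← Finset.sum_add_distrib]
    refine Finset.sum_congr rfl fun a _ => ?_
    rw [← smul_add, sub_add_cancel]
  have h2 := hb k hk1 ((net.faces * dil k) • x)
  simp only [smul_zero, Finset.sum_const_zero, sub_zero] at h2
  rw [h1, add_sub_assoc]
  exact (norm_add_le _ _).trans ((add_le_add_left h2 _).trans hk)

/-! ### Convergence of the normals -/

/-- The constant part `q` of the control points drops out of the derivatives; what remains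
is a positive multiple of the cross product of the derivatives for the data `z`. -/
theorem normalDir_eq {𝒮 : Scheme E n p} {R k : ℕ} (hφ1 : ContDiff ℝ 1 (basicLimit 𝒮.mask k))
    (hφ : ∀ x, R < ‖x‖ → basicLimit 𝒮.mask k x = 0) {D : Idx E n p → Fin 3 → ℝ}
    {q : Fin 3 → ℝ} {t : ℝ} {z : Idx E n p → Fin 3 → ℝ}
    (hd : ∀ a, controlPoints 𝒮.mat D k a = q + t • z a) {l : ZMod n} {i : Fin 3} {α : ℝ}
    (hα : ∀ x ∈ cell net.meshType k i,
      ∑ a, basisVec net (basicLimit 𝒮.mask k) k l i x a = α)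
    {x : ℝ × ℝ} (hx : x ∈ cell net.meshType k i) :
    normalDir net 𝒮 D k l i x = (net.faces * dil k * t) ^ 2 • crossProduct
      (dirSum (basicLimit 𝒮.mask k) (reach net R) (fun β => z (rotate l (net.label i β))) (1, 0)
        ((net.faces * dil k) • x))
      (dirSum (basicLimit 𝒮.mask k) (reach net R) (fun β => z (rotate l (net.label i β))) (0, 1)
        ((net.faces * dil k) • x)) := by
  have hY : ‖(net.faces * dil k) • x‖ < net.faces * 2 + 1 :=
    (norm_smul_le_of_mem_cell net hx).trans_lt (by linarith)
  obtain ⟨hu, hv⟩ := partials_sum_basisVec net hφ1 hφ l i hY (controlPoints 𝒮.mat D k)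
  have hu' : partialU (ringPatch net 𝒮 D k l i) x = _ := hu
  have hv' : partialV (ringPatch net 𝒮 D k l i) x = _ := hv
  have hz := dirSum_const_eq_zero net hφ1 hφ l hα hx
  rw [normalDir, hu', hv']
  simp only [hd]
  rw [dirSum_add_smul, dirSum_add_smul, hz, hz, zero_smul, zero_add]
  simp only [map_smul, LinearMap.smul_apply, zero_add, smul_smul]
  congr 1
  ring

/-- The Jacobian determinant of the characteristic map in rescaled coordinates. -/
def jac (φ : ℝ × ℝ → ℝ) (Q : Finset (ℤ × ℤ)) (a b : ℤ × ℤ → ℝ) (y : ℝ × ℝ) : ℝ :=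
  dirSum φ Q a (1, 0) y * dirSum φ Q b (0, 1) y - dirSum φ Q b (1, 0) y * dirSum φ Q a (0, 1) y

theorem exists_sign_jac_lower_bound {c : Mask} {v : Fin 2 → Idx E n p → ℝ} {R : ℕ}
    (hφ1 : ContDiff ℝ 1 (basicLimit (fun _ => c) 1))
    (hφ : ∀ x, R < ‖x‖ → basicLimit (fun _ => c) 1 x = 0) {s : SignType} (hs : s ≠ 0)
    (h : ∀ l i, ∀ x ∈ cell net.meshType 1 i, SignType.sign (Matrix.det
      !![partialU (charRing net c (v 0) l i) x, partialU (charRing net c (v 1) l i) x;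
        partialV (charRing net c (v 0) l i) x, partialV (charRing net c (v 1) l i) x]) = s) :
    ∃ σ : ℝ, σ * σ = 1 ∧ ∀ (l : ZMod n) (i : Fin 3), ∃ δ > 0, ∀ X ∈ baseCell net.meshType i,
      δ ≤ σ * jac (basicLimit (fun _ => c) 1) (reach net R)
        (fun β => v 0 (rotate l (net.label i β))) (fun β => v 1 (rotate l (net.label i β)))
        ((net.faces : ℝ) • X) := by
  have hsign : ∃ σ : ℝ, σ * σ = 1 ∧ ∀ r : ℝ, SignType.sign r = s → 0 < σ * r := by
    rcases s.trichotomy with rfl | rfl | rfl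
    · exact ⟨-1, by norm_num, fun r hr => by linarith [sign_eq_neg_one_iff.1 hr]⟩
    · exact absurd rfl hs
    · exact ⟨1, by norm_num, fun r hr => by linarith [sign_eq_one_iff.1 hr]⟩
  obtain ⟨σ, hσ, hpos⟩ := hsign
  refine ⟨σ, hσ, fun l i => ?_⟩
  set a : ℤ × ℤ → ℝ := fun β => v 0 (rotate l (net.label i β)) with ha
  set b : ℤ × ℤ → ℝ := fun β => v 1 (rotate l (net.label i β)) with hb
  set φ := basicLimit (fun _ => c) 1 with hφdef
  have hf : (0 : ℝ) < net.faces := Nat.cast_pos.2 net.faces_pos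
  have hJpos : ∀ X ∈ baseCell net.meshType i,
      0 < σ * jac φ (reach net R) a b ((net.faces : ℝ) • X) := by
    intro X hX
    have hX1 : X ∈ cell net.meshType 1 i := by rwa [mem_cell_iff, dil_one, one_smul]
    have hY : ‖(net.faces * dil 1) • X‖ < net.faces * 2 + 1 :=
      (norm_smul_le_of_mem_cell net hX1).trans_lt (by linarith)
    have hp := fun j => partials_sum_basisVec net hφ1 hφ l i hY (v j)
    have hu : ∀ j, partialU (charRing net c (v j) l i) X = _ := fun j => (hp j).1
    have hv : ∀ j, partialV (charRing net c (v j) l i) X = _ := fun j => (hp j).2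
    have h1 := hpos _ (h l i X hX1)
    rw [Matrix.det_fin_two_of, hu, hu, hv, hv] at h1
    simp only [dil_one, mul_one, smul_eq_mul] at h1
    have h2 : 0 < (net.faces : ℝ) ^ 2 * (σ * jac φ (reach net R) a b ((net.faces : ℝ) • X)) := by
      refine h1.trans_eq ?_
      rw [jac]; ring
    exact pos_of_mul_pos_right h2 (by positivity)
  have hcont : Continuous fun X => σ * jac φ (reach net R) a b ((net.faces : ℝ) • X) := by
    have hc := fun (d : ℤ × ℤ → ℝ) h => (continuous_dirSum hφ1 (reach net R) d h).comp
      (continuous_const_smul (net.faces : ℝ))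
    exact continuous_const.mul (((hc a (1, 0)).mul (hc b (0, 1))).sub
      ((hc b (1, 0)).mul (hc a (0, 1))))
  have hne : (baseCell net.meshType i).Nonempty := by
    obtain ⟨x, hx⟩ := exists_ball_subset_baseCell net.meshType i
    exact ⟨x, hx (Metric.mem_ball_self (by norm_num))⟩
  obtain ⟨X₀, hX₀, hmin⟩ :=
    (isCompact_baseCell net.meshType i).exists_isMinOn hne hcont.continuousOn
  exact ⟨_, hJpos X₀ hX₀, fun X hX => hmin hX⟩

/-- A uniformly small perturbation of `J • m` has nearly the unit normal of `σ • m`, where `σ = ±1`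
is the sign of `J`. -/
theorem exists_normalize_close {m : Fin 3 → ℝ} (hm : m ≠ 0) {σ δ : ℝ} (hσ : σ * σ = 1) (hδ : 0 < δ)
    {ε : ℝ} (hε : 0 < ε) : ∃ ρ > 0, ∀ (J : ℝ) (w : Fin 3 → ℝ), δ ≤ σ * J → ‖w - J • m‖ ≤ ρ →
      w ≠ 0 ∧ ‖normalize w - normalize (σ • m)‖ ≤ ε := by
  have hσ0 : σ ≠ 0 := fun h => by simp [h] at hσ
  have hσm : σ • m ≠ 0 := smul_ne_zero hσ0 hm
  obtain ⟨r, hr0, hr⟩ := Metric.continuousAt_iff.1 (continuousAt_normalize hσm) ε hε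
  have hnm : 0 < ‖σ • m‖ := norm_pos_iff.2 hσm
  refine ⟨δ * (min r ‖σ • m‖ / 2), by positivity, fun J w hJ hw => ?_⟩
  have hJ0 : 0 < σ * J := hδ.trans_le hJ
  set w' := (σ * J)⁻¹ • w with hw'
  have e : w' - σ • m = (σ * J)⁻¹ • (w - J • m) := by
    have h1 : (σ * J)⁻¹ * J = σ := by
      have hJne : J ≠ 0 := right_ne_zero_of_mul hJ0.ne'
      field_simp
      rw [pow_two, hσ]
    rw [smul_sub, smul_smul, h1]
  have hdist : ‖w' - σ • m‖ < min r ‖σ • m‖ := by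
    have hmin : 0 < min r ‖σ • m‖ := lt_min hr0 hnm
    rw [e, norm_smul, norm_inv, Real.norm_of_nonneg hJ0.le, inv_mul_lt_iff₀ hJ0]
    calc ‖w - J • m‖ ≤ δ * (min r ‖σ • m‖ / 2) := hw
      _ < δ * min r ‖σ • m‖ := by
          have := mul_pos hδ hmin
          linarith
      _ ≤ σ * J * min r ‖σ • m‖ := mul_le_mul_of_nonneg_right hJ hmin.le
  constructor
  · rintro rfl
    have h1 := hdist.trans_le (min_le_right _ _)
    rw [hw', smul_zero, zero_sub, norm_neg] at h1
    exact lt_irrefl _ h1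
  · have h1 := (hr (x := w') (by rw [dist_eq_norm]; exact hdist.trans_le (min_le_left _ _))).le
    rwa [hw', normalize_smul (inv_pos.2 hJ0), dist_eq_norm] at h1

theorem normals_tendsto {𝒮 : Scheme E n p} {c : Mask} {v : Fin 2 → Idx E n p → ℝ} {R : ℕ}
    {η : ℕ → ℝ} {K : ℝ}
    (hφ : C1Approx (basicLimit 𝒮.mask) (basicLimit (fun _ => c) 1) R η K) {α : ℕ → ℝ}
    (hα : ∀ k, 1 ≤ k → ∀ l i, ∀ x ∈ cell net.meshType k i,
      ∑ a, basisVec net (basicLimit 𝒮.mask k) k l i x a = α k)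
    {σ : ℝ} (hσ : σ * σ = 1)
    (hJ : ∀ (l : ZMod n) (i : Fin 3), ∃ δ > 0, ∀ X ∈ baseCell net.meshType i,
      δ ≤ σ * jac (basicLimit (fun _ => c) 1) (reach net R)
        (fun β => v 0 (rotate l (net.label i β))) (fun β => v 1 (rotate l (net.label i β)))
        ((net.faces : ℝ) • X))
    {D : Idx E n p → Fin 3 → ℝ} {q : ℕ → Fin 3 → ℝ} {t : ℕ → ℝ} {z : ℕ → Idx E n p → Fin 3 → ℝ}
    (hd : ∀ k, 1 ≤ k → 0 < t k ∧ ∀ a, controlPoints 𝒮.mat D k a = q k + t k • z k a)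
    {A B : Fin 3 → ℝ} (hz : ∀ a, Tendsto (fun k => z k a) atTop (𝓝 (v 0 a • A + v 1 a • B)))
    (hAB : crossProduct A B ≠ 0) {ε : ℝ} (hε : 0 < ε) :
    ∀ᶠ k : ℕ in atTop, ∀ l i, ∀ x ∈ cell net.meshType k i, normalDir net 𝒮 D k l i x ≠ 0 ∧
      ‖unitNormal net 𝒮 D k l i x - normalize (σ • crossProduct A B)‖ ≤ ε := by
  rw [eventually_all]
  intro l
  rw [eventually_all]
  intro i
  set Q := reach net R with hQ
  set φ := basicLimit (fun _ => c) 1 with hφdef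
  set a : ℤ × ℤ → ℝ := fun β => v 0 (rotate l (net.label i β)) with ha
  set b : ℤ × ℤ → ℝ := fun β => v 1 (rotate l (net.label i β)) with hb
  obtain ⟨δ, hδ, hδJ⟩ := hJ l i
  obtain ⟨ρ, hρ, hclose⟩ := exists_normalize_close hAB hσ hδ hε
  have hu1 : ‖((1, 0) : ℝ × ℝ)‖ ≤ 1 := by simp [Prod.norm_def]
  have hv1 : ‖((0, 1) : ℝ × ℝ)‖ ≤ 1 := by simp [Prod.norm_def]
  have hz' : ∀ β : ℤ × ℤ, Tendsto (fun k => z k (rotate l (net.label i β))) atTop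
      (𝓝 (a β • A + b β • B)) := fun β => hz _
  obtain ⟨bu, hbu0, hbu⟩ := hφ.exists_dirSum_bound Q hz' hu1
  obtain ⟨bv, hbv0, hbv⟩ := hφ.exists_dirSum_bound Q hz' hv1
  set D' : ℤ × ℤ → Fin 3 → ℝ := fun β => a β • A + b β • B with hD'
  set W := ∑ β ∈ Q, K * ‖D' β‖ with hW
  have hlim : Tendsto (fun k => 2 * bu k * (bv k + W) + 2 * W * bv k) atTop (𝓝 0) := by
    simpa using ((hbu0.const_mul 2).mul (hbv0.add_const W)).add (hbv0.const_mul (2 * W))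
  filter_upwards [hlim.eventually_le_const hρ, eventually_ge_atTop 1] with k hk hk1 x hx
  obtain ⟨ht, hdk⟩ := hd k hk1
  set y := (net.faces * dil k) • x with hy
  have hN := normalDir_eq net (hφ.contDiff k hk1) (hφ.eq_zero k hk1) hdk
    (hα k hk1 l i) hx
  rw [← hy, ← hQ] at hN
  set U := dirSum (basicLimit 𝒮.mask k) Q (fun β => z k (rotate l (net.label i β))) (1, 0) y
  set V := dirSum (basicLimit 𝒮.mask k) Q (fun β => z k (rotate l (net.label i β))) (0, 1) y
  set U' := dirSum φ Q D' (1, 0) y with hU'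
  set V' := dirSum φ Q D' (0, 1) y with hV'
  have hUV' : crossProduct U' V' = jac φ Q a b y • crossProduct A B := by
    rw [hU', hV', hD', dirSum_smul_add, dirSum_smul_add, cross_add_smul]; rfl
  have hdU : ‖U - U'‖ ≤ bu k := hbu k hk1 y
  have hdV : ‖V - V'‖ ≤ bv k := hbv k hk1 y
  have hWU : ‖U'‖ ≤ W := hφ.norm_dirSum_le Q D' hu1 y
  have hWV : ‖V'‖ ≤ W := hφ.norm_dirSum_le Q D' hv1 y
  have hV : ‖V‖ ≤ bv k + W := by
    have e : V = (V - V') + V' := (sub_add_cancel V V').symm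
    rw [e]
    exact (norm_add_le _ _).trans (add_le_add hdV hWV)
  have herr : ‖crossProduct U V - jac φ Q a b y • crossProduct A B‖ ≤ ρ := by
    have e : crossProduct U V - crossProduct U' V'
        = crossProduct (U - U') V + crossProduct U' (V - V') := by
      simp only [map_sub, LinearMap.sub_apply]; abel
    rw [← hUV', e]
    refine (norm_add_le _ _).trans ((add_le_add (norm_cross_le _ _) (norm_cross_le _ _)).trans
      (le_trans ?_ hk))
    have hW0 : 0 ≤ W := (norm_nonneg _).trans hWU
    have hbu' : 0 ≤ bu k := (norm_nonneg _).trans hdU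
    gcongr
  have hδy : δ ≤ σ * jac φ Q a b y := by
    have := hδJ _ hx
    rwa [← mul_smul] at this
  obtain ⟨hne, hclose'⟩ := hclose _ _ hδy herr
  have hpos : 0 < (net.faces * dil k * t k) ^ 2 := by
    have h1 : (0 : ℝ) < net.faces := Nat.cast_pos.2 net.faces_pos
    have h2 := dil_pos k
    positivity
  constructor
  · rw [hN]
    exact smul_ne_zero hpos.ne' hne
  · have h1 : unitNormal net 𝒮 D k l i x = normalize (normalDir net 𝒮 D k l i x) := rfl
    rw [h1, hN, normalize_smul hpos]
    exact hclose'

/-! ### Convergence in regular regions -/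

theorem c1Convergent_of_asympEquiv {ck : ℕ → Mask} {c : Mask} (hc : C1Convergent fun _ => c)
    (hw : Summable (weight ck c)) (hns : NonSingularRegular ck) : C1Convergent ck := by
  obtain ⟨K, hK⟩ := exists_limit_of_asympEquiv hc hw
  refine ⟨⟨fun f ⟨B, hB⟩ => ?_, ?_⟩, fun f g ⟨B, hB⟩ hg => ?_⟩
  · obtain ⟨g, hg, -⟩ := hK 1 le_rfl f B hB
    exact ⟨g, hg⟩
  · obtain ⟨g, hg, -⟩ := hK 1 le_rfl delta 1 abs_delta_le
    refine ⟨delta, g, boundedData_delta, hg, ?_⟩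
    rintro rfl
    have h := congrFun (hns delta boundedData_delta hg) 0
    simp [delta] at h
  · obtain ⟨g', hg', h1, -⟩ := hK 1 le_rfl f B hB
    rwa [hg.unique hg']

end Normals

end

end Subdiv

theorem theorem2 {E : Subdiv.ExtraElem} {n p : ℕ} [NeZero n]
    (net : Subdiv.ControlNet E n p) (𝒮 : Subdiv.Scheme E n p)
    (c : Subdiv.Mask) (S : Matrix (Subdiv.Idx E n p) (Subdiv.Idx E n p) ℝ) (l₁ : ℝ)
    (hns : 𝒮.NonSingular)
    (hα : ∃ α : ℕ → ℝ, ∀ k, 1 ≤ k → ∀ l i, ∀ x ∈ Subdiv.cell net.meshType k i,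
      ∑ a, Subdiv.basisVec net (Subdiv.basicLimit 𝒮.mask k) k l i x a = α k)
    (hsymm : Subdiv.RotSymm S) (hstd : Subdiv.IsStandard S l₁)
    (hC1 : Subdiv.C1Convergent fun _ => c) (hfac : Subdiv.HasFactor c)
    (hchar : Subdiv.RegularCharMap net c S l₁)
    (hfack : ∀ k, 1 ≤ k → Subdiv.HasFactor (𝒮.mask k))
    (hae : Subdiv.AsympEquivOrderOne 𝒮.mask c)
    (hS : ∃ C σ : ℝ, 1 / l₁ < σ ∧
      ∀ k, 1 ≤ k → Subdiv.rowSumNorm (𝒮.mat k - S) ≤ C / σ ^ k) :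
    Subdiv.NormalContinuous net 𝒮 := by
  have hw : Summable (Subdiv.weight 𝒮.mask c) := (summable_nat_add_iff 1).1 hae
  obtain ⟨α, hα⟩ := hα
  obtain ⟨v, hv, hvS, s, hs, hdet⟩ := hchar
  obtain ⟨R, η, K, hφ⟩ := Subdiv.exists_C1Approx 𝒮.mask_supp hC1 hw
  obtain ⟨L₀, L₁, L₂, h0, h1, hind⟩ :=
    Subdiv.exists_controlPoints_asymptotics hstd hv hvS hns.2 hS
  obtain ⟨σ, hσ, hJ⟩ :=
    Subdiv.exists_sign_jac_lower_bound net hφ.contDiff_lim hφ.eq_zero_lim hs hdet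
  refine ⟨Subdiv.c1Convergent_of_asympEquiv hC1 hw hns.1,
    Subdiv.convergentIrregular_of_approx net hφ hα fun D => ⟨_, h0 D⟩, ?_⟩
  filter_upwards [Subdiv.ae_cross_ne_zero hind] with D hD
  obtain ⟨q, t, z, hd, hz⟩ := h1 D
  have key := fun {ε : ℝ} (hε : 0 < ε) =>
    Subdiv.normals_tendsto net hφ hα hσ hJ hd hz hD hε
  refine ⟨(key one_pos).mono fun k hk l i x hx => (hk l i x hx).1, _,
    fun ε hε => (key hε).mono fun k hk l i x hx => (hk l i x hx).2, fun ν hν => ?_⟩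
  exact hν.unique fun ε hε => (key hε).mono fun k hk l i x hx => (hk l i x hx).2
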